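/- **Newton relations for the quantum matrix algebra $\mathcal M(\hat R,\hat F)$.** Let $V$ be a finite-dimensional vector space with a fixed basis over a field $K$, let $q\in K$, $q\neq 0$, and put $k_q:=q^{k-1}+q^{k-3}+\dots+q^{1-k}$ (which is $(q^k-q^{-k})/(q-q^{-1})$ when $q\ne\pm1$). Assume $k_q\neq 0$ for all $k\ge 1$. For $X\in\mathrm{End}(V\otimes V)$ let $X_i$ denote $X$ acting in the $i$-th and $(i+1)$-st factors of $V^{\otimes m}$. An *R-matrix* is an $X\in \mathrm{Aut}(V\otimes V)$ with $X_1X_2X_1=X_2X_1X_2$. Let $\hat R,\hat F$ be R-matrices such that: * they are compatible: $\hat R_1\hat F_2\hat F_1=\hat F_2\hat F_1\hat R_2$ and $\hat F_1\hat F_2\hat R_1=\hat R_2\hat F_1\hat F_2$; * $\hat R$ is an even Hecke R-matrix of height $n\ge1$: $\hat R^2=I+(q-q^{-1})\hat R$, $A^{(n+1)}=0$ and $\mathrm{rank}\,A^{(n)}=1$, where $A^{(1)}=S^{(1)}=I$ and, for $k\ge 2$, $$A^{(k)}=\tfrac1{k_q}A^{(k-1)}\bigl(q^{k-1}-(k-1)_q\hat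 R_{k-1}\bigr)A^{(k-1)},\qquad S^{(k)}=\tfrac1{k_q}S^{(k-1)}\bigl(q^{1-k}+(k-1)_q\hat R_{k-1}\bigr)S^{(k-1)};$$ * $\hat F$ is closed: there is a matrix $\Psi$ with $\sum_{f,g}\Psi^{af}_{cg}\hat F^{gb}_{fd}=\delta^a_d\delta^b_c$ for all $a,b,c,d$. Put $D^a_b=\sum_c\Psi^{ac}_{bc}$ and, for a matrix $X$ on $V^{\otimes k}$ with entries in a $K$-algebra, $\mathrm{Tr}_{\hat F(1\dots k)}X=\mathrm{Tr}\bigl(D^{\otimes k}X\bigr)$. For a matrix $M$ on $V$ with entries in a $K$-algebra let $M_{\overline 1}=M_1$ (that is, $M$ acting in the first factor) and $M_{\overline{k+1}}=\hat F_kM_{\overline k}\hat F_k^{-1}$. Let $\mathcal M(\hat R,\hat F)$ be the unital associative $K$-algebra generated by the entries of a matrix $M$ on $V$ subject to the relations $\hat R_1M_{\overline1}M_{\overline2}=M_{\overline1}M_{\overline2}\,(\hat F^{2}\hat R\hat F^{-2})_1$. In this algebra put $s_0(M)=\sigma_0(M)=\tau_0(M)=1$ and, for $k\ge1$, $$s_k(M)=\mathrm{Tr}_{\hat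 F(1\dots k)}\bigl(\hat R_1\hat R_2\cdots\hat R_{k-1}M_{\overline1}\cdots M_{\overline k}\bigr),$$ $$\sigma_k(M)=\mathrm{Tr}_{\hat F(1\dots k)}\bigl(A^{(k)}M_{\overline1}\cdots M_{\overline k}\bigr),\qquad \tau_k(M)=\mathrm{Tr}_{\hat F(1\dots k)}\bigl(S^{(k)}M_{\overline1}\cdots M_{\overline k}\bigr).$$ Then for every $k\ge1$ the following identities hold in $\mathcal M(\hat R,\hat F)$: $$(-1)^{k-1}k_q\,\sigma_k(M)=\sum_{i=0}^{k-1}(-q)^i\,s_{k-i}(M)\,\sigma_i(M),\qquad k_q\,\tau_k(M)=\sum_{i=0}^{k-1}q^{-i}\,s_{k-i}(M)\,\tau_i(M).$$ -/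

import Mathlib

namespace QuantumMatrix

section Scalars

variable {K : Type*} [Field K]

/-- The `q`-number `k_q = q^(k-1) + q^(k-3) + ... + q^(1-k)`. -/
def qInt (q : K) (k : ℕ) : K :=
  ∑ j ∈ Finset.range k, q ^ ((k : ℤ) - 1 - 2 * (j : ℤ))

/-- For `q ≠ ± 1`, the `q`-number is the usual quotient. -/
theorem qInt_eq_div (q : K) (hq : q ≠ 0) (h1 : q - q⁻¹ ≠ 0) (k : ℕ) :
    qInt q k = (q ^ (k : ℤ) - q ^ (-(k : ℤ))) / (q - q⁻¹) := by
  rw [eq_div_iff h1, qInt, Finset.sum_mul]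
  have key : ∀ j : ℕ, q ^ ((k : ℤ) - 1 - 2 * (j : ℤ)) * (q - q⁻¹)
      = q ^ ((k : ℤ) - 2 * (j : ℤ)) - q ^ ((k : ℤ) - 2 * ((j + 1 : ℕ) : ℤ)) := by
    intro j
    have e1 : (k : ℤ) - 2 * (j : ℤ) = ((k : ℤ) - 1 - 2 * (j : ℤ)) + 1 := by ring
    have e2 : (k : ℤ) - 2 * ((j + 1 : ℕ) : ℤ) = ((k : ℤ) - 1 - 2 * (j : ℤ)) - 1 := by
      push_cast; ring
    rw [e1, e2, zpow_add_one₀ hq, zpow_sub_one₀ hq]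
    ring
  rw [Finset.sum_congr rfl (fun j _ => key j),
    Finset.sum_range_sub' (fun j : ℕ => q ^ ((k : ℤ) - 2 * (j : ℤ)))]
  have e3 : (k : ℤ) - 2 * ((0 : ℕ) : ℤ) = k := by simp
  have e4 : (k : ℤ) - 2 * (k : ℤ) = -k := by ring
  rw [e3, e4]

end Scalars

section Legs

variable {ι A : Type*} [DecidableEq ι] [Zero A] [One A]

/-- Endomorphisms of `V^{⊗ m}`, where `V` has a basis indexed by `ι`, are matrices with rows and
columns indexed by `Fin m → ι`. For a matrix `X` on `V ⊗ V`, `site X m i` is the operator `X`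
acting in the factors number `i` and `i + 1` of `V^{⊗ m}`, counted from `0`, and as the identity
in the other factors. (So `site X m i` is `X_{i+1}` when the factors are counted from `1`.)
It is meant for `i + 1 < m`, the default value `1` is never used. -/
def site (X : Matrix (ι × ι) (ι × ι) A) (m i : ℕ) : Matrix (Fin m → ι) (Fin m → ι) A :=
  if h : i + 1 < m then
    Matrix.of fun a b =>
      if ∀ l : Fin m, (l : ℕ) ≠ i → (l : ℕ) ≠ i + 1 → a l = b l then
        X (a ⟨i, Nat.lt_of_succ_lt h⟩, a ⟨i + 1, h⟩) (b ⟨i, Nat.lt_of_succ_lt h⟩, b ⟨i + 1, h⟩)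
      else 0
  else 1

/-- The matrix `M_1`: `M` acting in the first factor of `V^{⊗ m}` (meant for `0 < m`). -/
def firstSite (M : Matrix ι ι A) (m : ℕ) : Matrix (Fin m → ι) (Fin m → ι) A :=
  if h : 0 < m then
    Matrix.of fun a b =>
      if ∀ l : Fin m, (l : ℕ) ≠ 0 → a l = b l then M (a ⟨0, h⟩) (b ⟨0, h⟩) else 0
  else 1

end Legs

section RMatrices

variable {K ι : Type*} [Field K] [Fintype ι] [DecidableEq ι]

/-- An R-matrix: an invertible solution of `X_1 X_2 X_1 = X_2 X_1 X_2` on `V^{⊗ 3}`. -/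
structure IsRMatrix (X : Matrix (ι × ι) (ι × ι) K) : Prop where
  isUnit : IsUnit X
  yangBaxter : site X 3 0 * site X 3 1 * site X 3 0 = site X 3 1 * site X 3 0 * site X 3 1

/-- Compatibility: `R_1 F_2 F_1 = F_2 F_1 R_2` and `F_1 F_2 R_1 = R_2 F_1 F_2`
(for two R-matrices). -/
structure Compatible (R F : Matrix (ι × ι) (ι × ι) K) : Prop where
  left : site R 3 0 * site F 3 1 * site F 3 0 = site F 3 1 * site F 3 0 * site R 3 1
  right : site F 3 0 * site F 3 1 * site R 3 0 = site R 3 1 * site F 3 0 * site F 3 1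

/-- The `q`-antisymmetrizer `A^{(k)}`, acting in the first `k` factors of `V^{⊗ m}`, `k ≤ m`. -/
def antisymmetrizer (q : K) (R : Matrix (ι × ι) (ι × ι) K) (m : ℕ) :
    ℕ → Matrix (Fin m → ι) (Fin m → ι) K
  | 0 => 1
  | 1 => 1
  | k + 2 => (qInt q (k + 2))⁻¹ •
      (antisymmetrizer q R m (k + 1) *
        (q ^ (k + 1) • (1 : Matrix (Fin m → ι) (Fin m → ι) K) - qInt q (k + 1) • site R m k) *
        antisymmetrizer q R m (k + 1))

/-- The `q`-symmetrizer `S^{(k)}`, acting in the first `k` factors of `V^{⊗ m}`, `k ≤ m`. -/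
def symmetrizer (q : K) (R : Matrix (ι × ι) (ι × ι) K) (m : ℕ) :
    ℕ → Matrix (Fin m → ι) (Fin m → ι) K
  | 0 => 1
  | 1 => 1
  | k + 2 => (qInt q (k + 2))⁻¹ •
      (symmetrizer q R m (k + 1) *
        (q⁻¹ ^ (k + 1) • (1 : Matrix (Fin m → ι) (Fin m → ι) K) + qInt q (k + 1) • site R m k) *
        symmetrizer q R m (k + 1))

/-- Even Hecke R-matrices of height `n` (where `q ≠ 0` and all `q`-numbers `k_q`, `k ≥ 1`, are
nonzero): `R² = 1 + (q - q⁻¹) R`, `A^{(n+1)} = 0` and `rank A^{(n)} = 1`. -/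
structure IsEvenHecke (q : K) (R : Matrix (ι × ι) (ι × ι) K) (n : ℕ) : Prop where
  isRMatrix : IsRMatrix R
  hecke : R * R = 1 + (q - q⁻¹) • R
  height_pos : 1 ≤ n
  antisymmetrizer_succ : antisymmetrizer q R (n + 1) (n + 1) = 0
  rank_antisymmetrizer : (antisymmetrizer q R n n).rank = 1

/-- `Ψ` inverts `F` in the indices `(a, c)`: `Ψ^{af}_{cg} F^{gb}_{fd} = δ^a_d δ^b_c`, summed over
`f` and `g`. The entry `F^{ab}_{cd}` is `F (a, b) (c, d)`. -/
def IsSkewInverse (F Ψ : Matrix (ι × ι) (ι × ι) K) : Prop :=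
  ∀ a b c d : ι, ∑ f : ι, ∑ g : ι, Ψ (a, f) (c, g) * F (g, b) (f, d) =
    if a = d ∧ b = c then 1 else 0

/-- A closed R-matrix: an R-matrix (in particular nonsingular) with a skew inverse. -/
structure IsClosedRMatrix (F : Matrix (ι × ι) (ι × ι) K) : Prop where
  isRMatrix : IsRMatrix F
  skewInvertible : ∃ Ψ : Matrix (ι × ι) (ι × ι) K, IsSkewInverse F Ψ

/-- `F` with its indices rearranged, so that a skew inverse becomes an inverse matrix. -/
def skewTranspose (F : Matrix (ι × ι) (ι × ι) K) : Matrix (ι × ι) (ι × ι) K :=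
  Matrix.of fun x y => F (x.2, y.2) (x.1, y.1)

/-- The skew inverse `Ψ` of `F`. -/
noncomputable def skewInverse (F : Matrix (ι × ι) (ι × ι) K) : Matrix (ι × ι) (ι × ι) K :=
  Matrix.of fun x y => (skewTranspose F)⁻¹ (x.1, y.1) (x.2, y.2)

/-- The skew inverse is unique and is given by `skewInverse`. -/
theorem IsSkewInverse.eq_skewInverse {F Ψ : Matrix (ι × ι) (ι × ι) K} (h : IsSkewInverse F Ψ) :
    Ψ = skewInverse F := by
  have key : (Matrix.of fun x y : ι × ι => Ψ (x.1, y.1) (x.2, y.2)) * skewTranspose F = 1 := by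
    ext ⟨a, c⟩ ⟨d, b⟩
    have := h a b c d
    simp only [Matrix.mul_apply, Fintype.sum_prod_type, Matrix.of_apply, skewTranspose, this,
      Matrix.one_apply, Prod.mk.injEq]
    congr 1
    simp [eq_comm]
  have := Matrix.inv_eq_left_inv key
  ext ⟨a, f⟩ ⟨c, g⟩
  simp [skewInverse, this]

/-- The matrix `D^a_b = Ψ^{ac}_{bc}`, summed over `c`. -/
noncomputable def dMatrix (F : Matrix (ι × ι) (ι × ι) K) : Matrix ι ι K :=
  Matrix.of fun a b => ∑ c : ι, skewInverse F (a, c) (b, c)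

/-- The twist `R^F = F R F⁻¹`. -/
noncomputable def twist (R F : Matrix (ι × ι) (ι × ι) K) : Matrix (ι × ι) (ι × ι) K :=
  F * R * F⁻¹

end RMatrices

section MatrixCopies

variable {K ι B : Type*} [Field K] [Fintype ι] [DecidableEq ι] [Semiring B] [Algebra K B]

/-- A scalar matrix, viewed as a matrix over a `K`-algebra `B`. -/
def scalarMap (B : Type*) [Semiring B] [Algebra K B] {κ : Type*} (X : Matrix κ κ K) :
    Matrix κ κ B :=
  X.map (algebraMap K B)

/-- The copies of `M` in `V^{⊗ m}`, numbered from `0`: the first is `M_1`, and each next one is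
obtained by conjugation with `F_1`, `F_2`, and so on. -/
noncomputable def copy (F : Matrix (ι × ι) (ι × ι) K) (M : Matrix ι ι B) (m : ℕ) :
    ℕ → Matrix (Fin m → ι) (Fin m → ι) B
  | 0 => firstSite M m
  | j + 1 => scalarMap B (site F m j) * copy F M m j * scalarMap B (site F⁻¹ m j)

/-- The product of the first `j` copies of `M`, in increasing order. -/
noncomputable def copyProd (F : Matrix (ι × ι) (ι × ι) K) (M : Matrix ι ι B) (m : ℕ) :
    ℕ → Matrix (Fin m → ι) (Fin m → ι) B
  | 0 => 1
  | j + 1 => copyProd F M m j * copy F M m j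

/-- The product `R_1 R_2 ... R_j` on `V^{⊗ m}`, `j + 1 ≤ m`. -/
def chain (R : Matrix (ι × ι) (ι × ι) K) (m : ℕ) : ℕ → Matrix (Fin m → ι) (Fin m → ι) K
  | 0 => 1
  | j + 1 => chain R m j * site R m j

/-- The quantum trace over all the factors of `V^{⊗ m}`: the trace of `(D ⊗ ... ⊗ D) X`. -/
noncomputable def qTrace (F : Matrix (ι × ι) (ι × ι) K) (m : ℕ)
    (X : Matrix (Fin m → ι) (Fin m → ι) B) : B :=
  (scalarMap B (Matrix.of fun a b : Fin m → ι => ∏ l, dMatrix F (a l) (b l)) * X).trace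

/-- The power sums `s_k(M)`. -/
noncomputable def powerSum (R F : Matrix (ι × ι) (ι × ι) K) (M : Matrix ι ι B) : ℕ → B
  | 0 => 1
  | k + 1 => qTrace F (k + 1) (scalarMap B (chain R (k + 1) k) * copyProd F M (k + 1) (k + 1))

/-- The elementary symmetric functions `σ_k(M)`. -/
noncomputable def elemSym (q : K) (R F : Matrix (ι × ι) (ι × ι) K) (M : Matrix ι ι B) : ℕ → B
  | 0 => 1
  | k + 1 => qTrace F (k + 1)
      (scalarMap B (antisymmetrizer q R (k + 1) (k + 1)) * copyProd F M (k + 1) (k + 1))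

/-- The complete symmetric functions `τ_k(M)`. -/
noncomputable def complSym (q : K) (R F : Matrix (ι × ι) (ι × ι) K) (M : Matrix ι ι B) : ℕ → B
  | 0 => 1
  | k + 1 => qTrace F (k + 1)
      (scalarMap B (symmetrizer q R (k + 1) (k + 1)) * copyProd F M (k + 1) (k + 1))

end MatrixCopies

section TheAlgebra

variable {K ι : Type*} [Field K] [Fintype ι] [DecidableEq ι]

/-- The matrix of free generators. -/
def freeMatrix (K ι : Type*) [Field K] : Matrix ι ι (FreeAlgebra K (ι × ι)) :=
  Matrix.of fun i j => FreeAlgebra.ι K (i, j)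

/-- The defining relations: the entries of `R_1 M_1 M_2 = M_1 M_2 R^{FF}_1`, where `M_1`, `M_2`
stand for the two copies of `M` in `V ⊗ V` and `R^{FF}` is the square of the twist. -/
inductive Rel (R F : Matrix (ι × ι) (ι × ι) K) :
    FreeAlgebra K (ι × ι) → FreeAlgebra K (ι × ι) → Prop
  | entry (a b : Fin 2 → ι) : Rel R F
      ((scalarMap (FreeAlgebra K (ι × ι)) (site R 2 0) *
        copy F (freeMatrix K ι) 2 0 * copy F (freeMatrix K ι) 2 1) a b)
      ((copy F (freeMatrix K ι) 2 0 * copy F (freeMatrix K ι) 2 1 *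
        scalarMap (FreeAlgebra K (ι × ι)) (site (twist (twist R F) F) 2 0)) a b)

/-- The quantum matrix algebra `M(R, F)`. -/
abbrev QMAlgebra (R F : Matrix (ι × ι) (ι × ι) K) : Type _ :=
  RingQuot (Rel R F)

/-- The matrix of generators of `M(R, F)`. -/
noncomputable def genMatrix (R F : Matrix (ι × ι) (ι × ι) K) : Matrix ι ι (QMAlgebra R F) :=
  Matrix.of fun i j => RingQuot.mkAlgHom K (Rel R F) (FreeAlgebra.ι K (i, j))

end TheAlgebra

end QuantumMatrix

/-!
The Newton relations are a statement about a trace on the Hecke algebra. On `V^{⊗ k}` consider the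
linear functional `t(X) = Tr_F (X M₁ ⋯ M_k)` of a scalar operator `X` (`traceFunctional`).

*Trace property.* The relations of the algebra give `R_i M₁ ⋯ M_k = M₁ ⋯ M_k R''_i`, where
`R'' = F² R F⁻²` (`BraidedSeq.r_mul_copyRange`), and the matrix `D` satisfies
`D₁ D₂ R = R'' D₁ D₂` (`kronecker_dMatrix_mul`). Hence `t(R_i X) = t(X R_i)`
(`traceFunctional_site_mul`).

*Factorization.* From `Tr_{F(2)} (F₁ Y₁ F₁⁻¹) = Tr_F(Y) 1` (`ptr_conj`), the quantum trace over the
last `i` factors of `A^{(i)} M_{j+1} ⋯ M_{j+i}`, with the antisymmetrizer placed in these factors,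
is `σ_i(M)` times the identity (`isPTr_traceAntisym`): conjugation with `F₁ ⋯ F_m` moves all
operators by one factor to the right. So the product `s_j σ_i` is the value of `t` on
`R₁ ⋯ R_{j-1} A^{(i)}`, with `A^{(i)}` in the last `i` factors (`powerSum_mul_traceAntisym`).

*Recursion.* Let `T_i = t(R₁ ⋯ R_{k-i-1} A^{(i+1)})`, with the antisymmetrizer in the last `i + 1`
factors. The expression of `A^{(i+1)}` by `A^{(i)}` in the last `i` factors
(`HeckeSeq.qInt_smul_qAntisym_left`), the trace property and `A^{(i)} A^{(i)} = A^{(i)}` give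
`(i+1)_q T_i = q^i s_{k-i} σ_i - i_q T_{i-1}` (`HeckeSeq.trace_step`). Since `T_{k-1} = σ_k`, this
telescopes to the first family of relations (`HeckeSeq.newton`). The second family is the first one
for the parameter `-q⁻¹`, which satisfies the same Hecke relation and turns antisymmetrizers into
symmetrizers (`complSym_eq`).

The two facts about `D` come from the skew inverse of `F`: contraction with `F` over its second
factor is injective (`IsSkewInverse.cancel`), so that an identity may be checked after such
contractions, where the Yang–Baxter and compatibility equations apply.
-/

namespace QuantumMatrix

/-! ### Antisymmetrizers in the Hecke algebra -/

section HeckeSequences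

variable {K E : Type*} [Field K] [Ring E] [Algebra K E]

theorem qInt_zero (q : K) : qInt q 0 = 0 := by simp [qInt]

theorem qInt_succ {q : K} (hq : q ≠ 0) (k : ℕ) : qInt q (k + 1) = q ^ k + q⁻¹ * qInt q k := by
  rw [qInt, Finset.sum_range_succ', qInt, Finset.mul_sum, add_comm]
  congr 1
  · simp
  · refine Finset.sum_congr rfl fun j _ => ?_
    rw [← zpow_neg_one, ← zpow_add₀ hq]
    congr 1
    push_cast
    ring

theorem qInt_one {q : K} (hq : q ≠ 0) : qInt q 1 = 1 := by
  simp [qInt_succ hq 0, qInt_zero]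

/-- The `q`-numbers at `-q⁻¹` are those at `q`, up to sign. -/
theorem qInt_neg_inv {q : K} (hq : q ≠ 0) (k : ℕ) :
    qInt (-q⁻¹) (k + 1) = (-1) ^ k * qInt q (k + 1) := by
  have hq' : -q⁻¹ ≠ 0 := neg_ne_zero.2 (inv_ne_zero hq)
  have h (k : ℕ) : qInt q (k + 1) = q⁻¹ ^ k + q * qInt q k := by
    rw [qInt, Finset.sum_range_succ, qInt, Finset.mul_sum, add_comm]
    congr 1
    · rw [inv_pow, ← zpow_natCast, ← zpow_neg]
      congr 1
      push_cast
      ring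
    · refine Finset.sum_congr rfl fun j _ => ?_
      rw [← zpow_one_add₀ hq]
      congr 1
      push_cast
      ring
  induction k with
  | zero => simp [qInt_one hq, qInt_one hq']
  | succ k ih =>
    rw [qInt_succ hq' (k + 1), ih, h (k + 1), neg_pow q⁻¹, inv_neg, inv_inv]
    ring

/-- A sequence of elements of which the first `N` satisfy the defining relations of the Hecke
algebra of type `A_N`. -/
structure HeckeSeq (q : K) (r : ℕ → E) (N : ℕ) : Prop where
  hecke : ∀ i < N, r i * r i = 1 + (q - q⁻¹) • r i
  braid : ∀ i, i + 1 < N → r i * r (i + 1) * r i = r (i + 1) * r i * r (i + 1)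
  comm : ∀ i j, i + 2 ≤ j → j < N → Commute (r i) (r j)

/-- The `q`-antisymmetrizer in the first `k - 1` members of a sequence. -/
def qAntisym (q : K) (r : ℕ → E) : ℕ → E
  | 0 => 1
  | 1 => 1
  | k + 2 => (qInt q (k + 2))⁻¹ •
      (qAntisym q r (k + 1) * (q ^ (k + 1) • (1 : E) - qInt q (k + 1) • r k) *
        qAntisym q r (k + 1))

theorem qAntisym_zero (q : K) (r : ℕ → E) : qAntisym q r 0 = 1 := rfl

theorem qAntisym_one (q : K) (r : ℕ → E) : qAntisym q r 1 = 1 := rfl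

theorem qAntisym_add_two (q : K) (r : ℕ → E) (k : ℕ) :
    qAntisym q r (k + 2) = (qInt q (k + 2))⁻¹ •
      (qAntisym q r (k + 1) * (q ^ (k + 1) • (1 : E) - qInt q (k + 1) • r k) *
        qAntisym q r (k + 1)) := rfl

theorem qAntisym_semiconj (q : K) {r r' : ℕ → E} {w : E} (k : ℕ)
    (h : ∀ i, i + 2 ≤ k → SemiconjBy w (r i) (r' i)) :
    SemiconjBy w (qAntisym q r k) (qAntisym q r' k) := by
  induction k using Nat.strong_induction_on with
  | _ k ih =>
    match k with
    | 0 => exact SemiconjBy.one_right w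
    | 1 => exact SemiconjBy.one_right w
    | k + 2 =>
      have h1 := ih (k + 1) (by omega) fun i hi => h i (by omega)
      have h2 := h k le_rfl
      have h3 : SemiconjBy w (q ^ (k + 1) • (1 : E) - qInt q (k + 1) • r k)
          (q ^ (k + 1) • (1 : E) - qInt q (k + 1) • r' k) := by
        simp only [SemiconjBy, mul_sub, sub_mul, mul_smul_comm, smul_mul_assoc, h2.eq,
          mul_one, one_mul]
      have h4 := (h1.mul_right h3).mul_right h1
      simp only [SemiconjBy, qAntisym_add_two, mul_smul_comm, smul_mul_assoc, h4.eq]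

theorem qAntisym_congr (q : K) {r r' : ℕ → E} (k : ℕ) (h : ∀ i, i + 2 ≤ k → r i = r' i) :
    qAntisym q r k = qAntisym q r' k := by
  have := qAntisym_semiconj q (r := r) (r' := r') (w := 1) k
    fun i hi => by rw [h i hi]; exact SemiconjBy.one_left _
  simpa [SemiconjBy] using this

theorem map_qAntisym {E' : Type*} [Ring E'] [Algebra K E'] (g : E →ₐ[K] E') (q : K) (r : ℕ → E)
    (k : ℕ) : g (qAntisym q r k) = qAntisym q (fun i => g (r i)) k := by
  induction k using Nat.strong_induction_on with
  | _ k ih =>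
    match k with
    | 0 => simp [qAntisym_zero]
    | 1 => simp [qAntisym_one]
    | k + 2 => simp [qAntisym_add_two, ih (k + 1) (by omega)]

theorem op_qAntisym (q : K) (r : ℕ → E) (k : ℕ) :
    MulOpposite.op (qAntisym q r k) = qAntisym q (fun i => MulOpposite.op (r i)) k := by
  induction k using Nat.strong_induction_on with
  | _ k ih =>
    match k with
    | 0 => rfl
    | 1 => rfl
    | k + 2 => simp [qAntisym_add_two, ← ih (k + 1) (by omega), mul_assoc]

namespace HeckeSeq

variable {q : K} {r : ℕ → E} {N : ℕ}

theorem shift (h : HeckeSeq q r N) (s n : ℕ) (hn : n + s ≤ N) :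
    HeckeSeq q (fun i => r (i + s)) n where
  hecke i hi := h.hecke _ (by omega)
  braid i hi := by
    have := h.braid (i + s) (by omega)
    rwa [show i + s + 1 = i + 1 + s by omega] at this
  comm i j hij hj := h.comm _ _ (by omega) (by omega)

theorem reverse (h : HeckeSeq q r N) : HeckeSeq q (fun i => r (N - 1 - i)) N where
  hecke i hi := h.hecke _ (by omega)
  braid i hi := by
    have := h.braid (N - 1 - (i + 1)) (by omega)
    rw [show N - 1 - (i + 1) + 1 = N - 1 - i by omega] at this
    exact this.symm
  comm i j hij hj := (h.comm _ _ (by omega) (by omega)).symm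

theorem op (h : HeckeSeq q r N) : HeckeSeq q (fun i => MulOpposite.op (r i)) N where
  hecke i hi := by
    rw [← MulOpposite.op_mul, h.hecke i hi]
    simp
  braid i hi := by
    simp only [← MulOpposite.op_mul, ← mul_assoc, h.braid i hi]
  comm i j hij hj := (h.comm i j hij hj).op

/-- Braid generators far to the right commute with an antisymmetrizer. -/
theorem commute_qAntisym (h : HeckeSeq q r N) {j k : ℕ} (hk : k ≤ j) (hj : j < N) :
    Commute (r j) (qAntisym q r k) :=
  qAntisym_semiconj q k fun i hi => (h.comm i j (by omega) hj).symm

/-- The inductive step for the absorption property. It is used with `a = A^{(k+1)}` and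
`b = A^{(k)}`, where `s` is the last generator which occurs in `a`, and `t` the next one. -/
theorem absorb_step {q : K} (hq : q ≠ 0) {a b s t : E} {c d p : K}
    (hab : d • a = b * (p • (1 : E) - c • s) * b) (hba : b * a = a)
    (haa : a * a = a) (htb : Commute t b) (hsa : s * a = (-q⁻¹) • a)
    (ht : t * t = 1 + (q - q⁻¹) • t) (hst : s * t * s = t * s * t) :
    t * (a * ((q * p) • (1 : E) - d • t) * a) =
      (-q⁻¹) • (a * ((q * p) • (1 : E) - d • t) * a) := by
  have hbta : b * (t * a) = t * a := by rw [← mul_assoc, ← htb.eq, mul_assoc, hba]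
  have h1 : c • (b * s * (t * a)) = p • (t * a) - d • (a * t * a) := by
    have : d • (a * t * a) = b * (p • (1 : E) - c • s) * (b * (t * a)) := by
      rw [mul_assoc a, ← smul_mul_assoc, hab]
      noncomm_ring
    rw [this, hbta]
    simp only [mul_sub, sub_mul, mul_smul_comm, smul_mul_assoc, mul_one, hbta]
    abel
  have h2 : t * s * (t * a) = (-q⁻¹) • (s * (t * a)) := by
    rw [← mul_assoc, ← hst, mul_assoc, hsa, mul_smul_comm, mul_assoc]
  have h3 : d • (t * (a * (t * a))) =
      p • a + (p * q) • (t * a) - (q⁻¹ * d) • (a * t * a) := by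
    have e1 : d • (t * (a * (t * a))) = b * (t * (p • (1 : E) - c • s) * (b * (t * a))) := by
      have : d • (t * (a * (t * a))) = t * ((d • a) * (t * a)) := by
        simp only [mul_smul_comm, smul_mul_assoc]
      rw [this, hab]
      simp only [← mul_assoc]
      rw [htb.eq]
    have e2 : b * (t * (t * a)) = a + (q - q⁻¹) • (t * a) := by
      rw [← mul_assoc t t a, ht, add_mul, one_mul, mul_add, hba, smul_mul_assoc, mul_smul_comm,
        hbta]
    have e3 : c • (b * (t * s * (t * a))) = (-q⁻¹) • (p • (t * a) - d • (a * t * a)) := by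
      rw [h2, mul_smul_comm, smul_comm, ← mul_assoc, h1]
    have e4 : b * (t * (p • (1 : E) - c • s) * (t * a)) =
        p • (b * (t * (t * a))) - c • (b * (t * s * (t * a))) := by
      simp only [mul_sub, sub_mul, mul_smul_comm, smul_mul_assoc, mul_one]
    rw [e1, hbta, e4, e2, e3]
    module
  have h4 : a * ((q * p) • (1 : E) - d • t) * a = (q * p) • a - d • (a * t * a) := by
    simp only [mul_sub, sub_mul, mul_smul_comm, smul_mul_assoc, mul_one, haa]
  rw [h4, mul_sub, mul_smul_comm, mul_smul_comm, mul_assoc a t a, h3, mul_assoc a t a]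
  have hqq : q⁻¹ * (q * p) = p := by field_simp
  simp only [smul_sub, smul_smul, neg_mul, hqq]
  module

theorem qInt_smul_qAntisym (hqInt : ∀ k : ℕ, 1 ≤ k → qInt q k ≠ 0) (r : ℕ → E) (k : ℕ) :
    qInt q (k + 2) • qAntisym q r (k + 2) =
      qAntisym q r (k + 1) * (q ^ (k + 1) • (1 : E) - qInt q (k + 1) • r k) *
        qAntisym q r (k + 1) := by
  rw [qAntisym_add_two, smul_inv_smul₀ (hqInt _ (by omega))]

/-- An element which absorbs the generators absorbs an antisymmetrizer. -/
theorem qAntisym_mul_of_absorb (hq : q ≠ 0) (hqInt : ∀ k : ℕ, 1 ≤ k → qInt q k ≠ 0)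
    {r : ℕ → E} {y : E} (k : ℕ) (hy : ∀ i, i + 2 ≤ k → r i * y = (-q⁻¹) • y) :
    qAntisym q r k * y = y := by
  induction k using Nat.strong_induction_on with
  | _ k ih =>
    match k with
    | 0 => rw [qAntisym_zero, one_mul]
    | 1 => rw [qAntisym_one, one_mul]
    | k + 2 =>
      have h1 := ih (k + 1) (by omega) fun i hi => hy i (by omega)
      have h2 : (q ^ (k + 1) • (1 : E) - qInt q (k + 1) • r k) * y = qInt q (k + 2) • y := by
        rw [sub_mul, smul_mul_assoc, smul_mul_assoc, one_mul, hy k le_rfl, qInt_succ hq (k + 1)]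
        module
      rw [qAntisym_add_two, smul_mul_assoc, mul_assoc, h1, mul_assoc, h2, mul_smul_comm, h1,
        inv_smul_smul₀ (hqInt _ (by omega))]

/-- The antisymmetrizer is an idempotent, and the generators act on it from the left as the
scalar `-q⁻¹`. -/
theorem qAntisym_idem_and_absorb (hq : q ≠ 0) (hqInt : ∀ k : ℕ, 1 ≤ k → qInt q k ≠ 0)
    (h : HeckeSeq q r N) (k : ℕ) (hk : k ≤ N) :
    qAntisym q r (k + 1) * qAntisym q r (k + 1) = qAntisym q r (k + 1) ∧
      ∀ i < k, r i * qAntisym q r (k + 1) = (-q⁻¹) • qAntisym q r (k + 1) := by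
  induction k with
  | zero => simp [qAntisym_one]
  | succ k ih =>
    obtain ⟨idem, absorb⟩ := ih (by omega)
    have hl : qAntisym q r (k + 1) * qAntisym q r (k + 2) = qAntisym q r (k + 2) := by
      rw [qAntisym_add_two, mul_smul_comm]
      simp only [← mul_assoc, idem]
    have hr : ∀ i < k + 1, r i * qAntisym q r (k + 2) = (-q⁻¹) • qAntisym q r (k + 2) := by
      intro i hi
      rcases Nat.lt_succ_iff_lt_or_eq.1 hi with hi | rfl
      · rw [← hl, ← mul_assoc, absorb i hi, smul_mul_assoc]
      · rw [qAntisym_add_two, mul_smul_comm, smul_comm (-q⁻¹)]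
        congr 1
        rcases i with _ | k
        · have h1 := h.hecke 0 (by omega)
          simp only [zero_add, qAntisym_one, one_mul, mul_one, mul_sub, mul_smul_comm, h1,
            qInt_one hq, pow_one, one_smul, smul_sub, smul_smul, neg_mul, inv_mul_cancel₀ hq]
          module
        · have hba : qAntisym q r (k + 1) * qAntisym q r (k + 2) = qAntisym q r (k + 2) :=
            qAntisym_mul_of_absorb hq hqInt _ fun i hi => absorb i (by omega)
          have := absorb_step hq (qInt_smul_qAntisym hqInt r k) hba idem
            (h.commute_qAntisym le_rfl (by omega)) (absorb k (by omega)) (h.hecke _ (by omega))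
            (h.braid k (by omega))
          rwa [← pow_succ' q (k + 1)] at this
    refine ⟨?_, hr⟩
    have h1 : qAntisym q r (k + 1) * (q ^ (k + 1) • (1 : E) - qInt q (k + 1) • r k) *
        qAntisym q r (k + 1) * qAntisym q r (k + 2) = qInt q (k + 2) • qAntisym q r (k + 2) := by
      rw [mul_assoc, hl, mul_assoc, sub_mul, smul_mul_assoc, smul_mul_assoc, one_mul,
        hr k (by omega), mul_sub, mul_smul_comm, mul_smul_comm, mul_smul_comm, hl,
        qInt_succ hq (k + 1)]
      module
    conv_lhs => rw [qAntisym_add_two q r k]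
    rw [smul_mul_assoc, ← qAntisym_add_two, h1, inv_smul_smul₀ (hqInt _ (by omega))]

theorem qAntisym_mul_self (hq : q ≠ 0) (hqInt : ∀ k : ℕ, 1 ≤ k → qInt q k ≠ 0)
    (h : HeckeSeq q r N) {k : ℕ} (hk : k ≤ N) :
    qAntisym q r (k + 1) * qAntisym q r (k + 1) = qAntisym q r (k + 1) :=
  (qAntisym_idem_and_absorb hq hqInt h k hk).1

theorem mul_qAntisym (hq : q ≠ 0) (hqInt : ∀ k : ℕ, 1 ≤ k → qInt q k ≠ 0)
    (h : HeckeSeq q r N) {i k : ℕ} (hk : k ≤ N) (hi : i < k) :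
    r i * qAntisym q r (k + 1) = (-q⁻¹) • qAntisym q r (k + 1) :=
  (qAntisym_idem_and_absorb hq hqInt h k hk).2 i hi

theorem qAntisym_mul (hq : q ≠ 0) (hqInt : ∀ k : ℕ, 1 ≤ k → qInt q k ≠ 0)
    (h : HeckeSeq q r N) {i k : ℕ} (hk : k ≤ N) (hi : i < k) :
    qAntisym q r (k + 1) * r i = (-q⁻¹) • qAntisym q r (k + 1) := by
  apply MulOpposite.op_injective
  simpa [op_qAntisym] using h.op.mul_qAntisym hq hqInt hk hi

/-- The antisymmetrizer built from right to left is the same: each of the two is absorbed by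
the other. -/
theorem qAntisym_reverse (hq : q ≠ 0) (hqInt : ∀ k : ℕ, 1 ≤ k → qInt q k ≠ 0)
    (h : HeckeSeq q r N) :
    qAntisym q (fun i => r (N - 1 - i)) (N + 1) = qAntisym q r (N + 1) := by
  have h1 : qAntisym q (fun i => r (N - 1 - i)) (N + 1) * qAntisym q r (N + 1) =
      qAntisym q r (N + 1) :=
    qAntisym_mul_of_absorb hq hqInt _ fun i hi => h.mul_qAntisym hq hqInt le_rfl (by omega)
  have h2 : qAntisym q (fun i => r (N - 1 - i)) (N + 1) * qAntisym q r (N + 1) =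
      qAntisym q (fun i => r (N - 1 - i)) (N + 1) := by
    apply MulOpposite.op_injective
    rw [MulOpposite.op_mul, op_qAntisym q r]
    refine qAntisym_mul_of_absorb hq hqInt _ fun i hi => ?_
    have := h.reverse.qAntisym_mul hq hqInt le_rfl (i := N - 1 - i) (by omega)
    rw [show N - 1 - (N - 1 - i) = i by omega] at this
    rw [← MulOpposite.op_mul, this, MulOpposite.op_smul]
  rw [← h2, h1]

/-- The recursion for the antisymmetrizer which adds a generator on the left instead of the
right. -/
theorem qInt_smul_qAntisym_left (hq : q ≠ 0) (hqInt : ∀ k : ℕ, 1 ≤ k → qInt q k ≠ 0)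
    {k : ℕ} (h : HeckeSeq q r (k + 1)) :
    qInt q (k + 2) • qAntisym q r (k + 2) =
      qAntisym q (fun i => r (i + 1)) (k + 1) *
        (q ^ (k + 1) • (1 : E) - qInt q (k + 1) • r 0) *
        qAntisym q (fun i => r (i + 1)) (k + 1) := by
  rw [← qAntisym_reverse hq hqInt h, qInt_smul_qAntisym hqInt,
    ← qAntisym_reverse hq hqInt (h.shift 1 k le_rfl)]
  have h1 : qAntisym q (fun i => r (k + 1 - 1 - i)) (k + 1) =
      qAntisym q (fun i => r (k - 1 - i + 1)) (k + 1) :=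
    qAntisym_congr q _ fun i hi => by congr 1; omega
  rw [h1]
  simp

end HeckeSeq

/-! ### Newton's recursion for a trace on the Hecke algebra -/

/-- The product `r_0 r_1 ⋯ r_{j-1}`. -/
def seqProd (r : ℕ → E) : ℕ → E
  | 0 => 1
  | j + 1 => seqProd r j * r j

theorem seqProd_commute {r : ℕ → E} {y : E} (j : ℕ) (h : ∀ i < j, Commute (r i) y) :
    Commute (seqProd r j) y := by
  induction j with
  | zero => exact Commute.one_left y
  | succ j ih => exact (ih fun i hi => h i (by omega)).mul_left (h j (by omega))

variable {B : Type*} [AddCommGroup B] [Module K B]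

theorem trace_qAntisym_comm (t : E →ₗ[K] B) (q : K) {r : ℕ → E} (k : ℕ)
    (h : ∀ i, i + 2 ≤ k → ∀ x, t (r i * x) = t (x * r i)) (x : E) :
    t (qAntisym q r k * x) = t (x * qAntisym q r k) := by
  induction k using Nat.strong_induction_on generalizing x with
  | _ k ih =>
    match k with
    | 0 => rw [qAntisym_zero, one_mul, mul_one]
    | 1 => rw [qAntisym_one, one_mul, mul_one]
    | k + 2 =>
      have h1 := ih (k + 1) (by omega) fun i hi => h i (by omega)
      have h2 (x : E) : t ((q ^ (k + 1) • (1 : E) - qInt q (k + 1) • r k) * x) =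
          t (x * (q ^ (k + 1) • (1 : E) - qInt q (k + 1) • r k)) := by
        simp only [mul_sub, sub_mul, mul_smul_comm, smul_mul_assoc, map_sub, map_smul,
          h k le_rfl x, mul_one, one_mul]
      rw [qAntisym_add_two, smul_mul_assoc, mul_smul_comm, map_smul, map_smul,
        mul_assoc (qAntisym q r (k + 1) * _), mul_assoc (qAntisym q r (k + 1)) _ (_ * x), h1,
        mul_assoc, h2, mul_assoc, mul_assoc, h1]
      simp only [mul_assoc]

/-- A linear functional which is a trace with respect to the Hecke generators satisfies the
recursion that underlies the Newton relations. -/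
theorem HeckeSeq.trace_step {q : K} (hq : q ≠ 0) (hqInt : ∀ k : ℕ, 1 ≤ k → qInt q k ≠ 0)
    {r : ℕ → E} {s k : ℕ} (h : HeckeSeq q r (s + (k + 1))) (t : E →ₗ[K] B)
    (ht : ∀ i < s + (k + 1), ∀ x, t (r i * x) = t (x * r i)) :
    qInt q (k + 2) • t (seqProd r s * qAntisym q (fun i => r (i + s)) (k + 2)) =
      q ^ (k + 1) • t (seqProd r s * qAntisym q (fun i => r (i + (s + 1))) (k + 1)) -
      qInt q (k + 1) • t (seqProd r (s + 1) * qAntisym q (fun i => r (i + (s + 1))) (k + 1)) := by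
  have h1 := qInt_smul_qAntisym_left hq hqInt (h.shift s (k + 1) (by omega))
  have h2 : (fun i => r (i + 1 + s)) = fun i => r (i + (s + 1)) := by
    funext i; congr 1; omega
  simp only [h2, zero_add] at h1
  set a := qAntisym q (fun i => r (i + (s + 1))) (k + 1) with ha
  -- `a` involves only the generators after `r s`, so it can be moved around the trace and merged
  -- with its second copy
  have h3 : Commute (seqProd r s) a := seqProd_commute s fun i hi =>
    qAntisym_semiconj q _ fun j hj => h.comm _ _ (by omega) (by omega)
  have h4 : a * a = a := (h.shift (s + 1) k (by omega)).qAntisym_mul_self hq hqInt le_rfl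
  have h5 (x : E) : t (a * x * a) = t (x * a) := by
    rw [mul_assoc, ha, trace_qAntisym_comm t q _ (fun i hi => ht _ (by omega)), ← ha, mul_assoc,
      h4]
  rw [← map_smul, ← mul_smul_comm, h1, ← mul_assoc, ← mul_assoc, h3.eq, mul_assoc a, h5]
  simp only [mul_sub, sub_mul, mul_smul_comm, smul_mul_assoc, map_sub, map_smul, mul_one, seqProd]
  rw [h3.eq]

/-- The Newton relations for a trace on the Hecke algebra. -/
theorem HeckeSeq.newton {q : K} (hq : q ≠ 0) (hqInt : ∀ k : ℕ, 1 ≤ k → qInt q k ≠ 0)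
    {r : ℕ → E} {N : ℕ} (h : HeckeSeq q r N) (t : E →ₗ[K] B)
    (ht : ∀ i < N, ∀ x, t (r i * x) = t (x * r i)) :
    ((-1) ^ N * qInt q (N + 1)) • t (qAntisym q r (N + 1)) =
      ∑ i ∈ Finset.range (N + 1), (-q) ^ i •
        t (seqProd r (N - i) * qAntisym q (fun j => r (j + (N + 1 - i))) i) := by
  have key (k : ℕ) (hk : k ≤ N) : ((-1) ^ k * qInt q (k + 1)) •
      t (seqProd r (N - k) * qAntisym q (fun i => r (i + (N - k))) (k + 1)) =
      ∑ i ∈ Finset.range (k + 1), (-q) ^ i •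
        t (seqProd r (N - i) * qAntisym q (fun j => r (j + (N + 1 - i))) i) := by
    induction k with
    | zero => simp [qInt_one hq, qAntisym_zero, qAntisym_one]
    | succ k ih =>
      obtain ⟨s, rfl⟩ := Nat.exists_eq_add_of_le' hk
      rw [Finset.sum_range_succ, ← ih (by omega), mul_smul,
        show s + (k + 1) - (k + 1) = s by omega, trace_step hq hqInt h t ht,
        show s + (k + 1) - k = s + 1 by omega, show s + (k + 1) + 1 - (k + 1) = s + 1 by omega,
        smul_sub, smul_smul, smul_smul, neg_pow q, pow_succ (-1 : K) k]
      module
  simpa [seqProd] using key N le_rfl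

end HeckeSequences

/-! ### Braided copies of an element -/

section BraidedCopies

variable {E : Type*} [Ring E]

/-- The algebraic relations among the operators `f i` (copies of `F`), their inverses `f' i`, the
operators `r i` (copies of `R`), of which the first `N` are subject to the braid relations, and an
element `x` in the first tensor factor. -/
structure BraidedSeq (f f' r : ℕ → E) (x : E) (N : ℕ) : Prop where
  mul_inv : ∀ i, f i * f' i = 1
  inv_mul : ∀ i, f' i * f i = 1
  braid : ∀ i, i + 1 < N → SemiconjBy (f i * f (i + 1)) (f i) (f (i + 1))
  braid' : ∀ i, i + 1 < N → SemiconjBy (f (i + 1) * f i) (f (i + 1)) (f i)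
  compat : ∀ i, i + 1 < N → SemiconjBy (f i * f (i + 1)) (r i) (r (i + 1))
  compat' : ∀ i, i + 1 < N → SemiconjBy (f (i + 1) * f i) (r (i + 1)) (r i)
  comm_ff : ∀ i j, i + 2 ≤ j → Commute (f i) (f j)
  comm_fr : ∀ i j, i + 2 ≤ j → Commute (f i) (r j)
  comm_rf : ∀ i j, i + 2 ≤ j → Commute (r i) (f j)
  comm_fx : ∀ i, Commute (f (i + 1)) x
  comm_rx : ∀ i, Commute (r (i + 1)) x

/-- The copies `x`, `f 0 * x * f' 0`, and so on. -/
def seqCopy (f f' : ℕ → E) (x : E) : ℕ → E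
  | 0 => x
  | j + 1 => f j * seqCopy f f' x j * f' j

/-- The product of the copies number `j`, ..., `j + i - 1`. -/
def copyRange (c : ℕ → E) (j : ℕ) : ℕ → E
  | 0 => 1
  | i + 1 => copyRange c j i * c (j + i)

/-- The inverse of `f 0 * ⋯ * f (n - 1)`. -/
def seqProdInv (f' : ℕ → E) : ℕ → E
  | 0 => 1
  | n + 1 => f' n * seqProdInv f' n

theorem semiconj_inv_left {w w' a b : E} (h : w' * w = 1) (h' : w * w' = 1)
    (hab : SemiconjBy w a b) : SemiconjBy w' b a := by
  have := hab.eq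
  calc w' * b = w' * (b * w) * w' := by rw [mul_assoc, mul_assoc, h', mul_one]
    _ = w' * (w * a) * w' := by rw [this]
    _ = a * w' := by rw [← mul_assoc w', h, one_mul]

namespace BraidedSeq

variable {f f' r : ℕ → E} {x : E} {N : ℕ}

theorem semiconj_copy (h : BraidedSeq f f' r x N) (j : ℕ) :
    SemiconjBy (f j) (seqCopy f f' x j) (seqCopy f f' x (j + 1)) := by
  rw [SemiconjBy, seqCopy, mul_assoc _ (f' j), h.inv_mul, mul_one]

/-- An operator that commutes with the braiding by which a copy is obtained commutes with it. -/
theorem commute_copy_of_le (h : BraidedSeq f f' r x N) {y : E} {l : ℕ} (hx : Commute y x)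
    (hf : ∀ i < l, Commute y (f i)) : Commute y (seqCopy f f' x l) := by
  induction l with
  | zero => exact hx
  | succ l ih =>
    have h1 := hf l (by omega)
    have h2 : Commute y (f' l) :=
      (semiconj_inv_left (h.inv_mul l) (h.mul_inv l) h1.symm).symm
    exact (h1.mul_right (ih fun i hi => hf i (by omega))).mul_right h2

theorem f_commute_copy_of_lt (h : BraidedSeq f f' r x N) {i l : ℕ} (hl : l < i) :
    Commute (f i) (seqCopy f f' x l) := by
  obtain ⟨i, rfl⟩ := Nat.exists_eq_add_of_lt hl
  exact h.commute_copy_of_le (h.comm_fx _) fun j hj => (h.comm_ff _ _ (by omega)).symm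

theorem r_commute_copy_of_lt (h : BraidedSeq f f' r x N) {i l : ℕ} (hl : l < i) :
    Commute (r i) (seqCopy f f' x l) := by
  obtain ⟨i, rfl⟩ := Nat.exists_eq_add_of_lt hl
  exact h.commute_copy_of_le (h.comm_rx _) fun j hj => (h.comm_fr _ _ (by omega)).symm

/-- An operator in the factors `i` and `i + 1` commutes with the later copies. -/
theorem commute_copy_of_add_two_le (h : BraidedSeq f f' r x N) {i l : ℕ} {y z : E}
    (hyz : SemiconjBy (f (i + 1) * f i) z y) (hz : Commute z (seqCopy f f' x i))
    (hy : ∀ j, i + 2 ≤ j → Commute y (f j)) (hl : i + 2 ≤ l) :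
    Commute y (seqCopy f f' x l) := by
  induction l, hl using Nat.le_induction with
  | base =>
    have h1 : SemiconjBy (f (i + 1) * f i) (seqCopy f f' x i) (seqCopy f f' x (i + 2)) :=
      (h.semiconj_copy (i + 1)).mul_left (h.semiconj_copy i)
    have h2 : (f (i + 1) * f i) * (f' i * f' (i + 1)) = 1 := by
      rw [mul_assoc, ← mul_assoc (f i), h.mul_inv, one_mul, h.mul_inv]
    have h3 : (f' i * f' (i + 1)) * (f (i + 1) * f i) = 1 := by
      rw [mul_assoc, ← mul_assoc (f' (i + 1)), h.inv_mul, one_mul, h.inv_mul]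
    have h4 : y = f (i + 1) * f i * z * (f' i * f' (i + 1)) := by
      rw [hyz.eq, mul_assoc, h2, mul_one]
    have h5 : seqCopy f f' x (i + 2) =
        f (i + 1) * f i * seqCopy f f' x i * (f' i * f' (i + 1)) := by
      rw [h1.eq, mul_assoc, h2, mul_one]
    have h6 (a b : E) : f (i + 1) * f i * a * (f' i * f' (i + 1)) *
        (f (i + 1) * f i * b * (f' i * f' (i + 1))) =
        f (i + 1) * f i * (a * b) * (f' i * f' (i + 1)) := by
      rw [mul_assoc, ← mul_assoc (f' i * f' (i + 1)), ← mul_assoc (f' i * f' (i + 1)), h3, one_mul]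
      simp only [mul_assoc]
    rw [Commute, SemiconjBy, h5, h4, h6, h6, hz.eq]
  | succ l hl ih =>
    have h1 := hy l hl
    have h2 : Commute y (f' l) :=
      (semiconj_inv_left (h.inv_mul l) (h.mul_inv l) h1.symm).symm
    exact (h1.mul_right ih).mul_right h2

theorem f_commute_copy (h : BraidedSeq f f' r x N) {i l : ℕ} (hi : i + 1 < N) (hl : i + 2 ≤ l) :
    Commute (f i) (seqCopy f f' x l) :=
  h.commute_copy_of_add_two_le (h.braid' i hi) (h.f_commute_copy_of_lt (by omega))
    (fun j hj => h.comm_ff i j hj) hl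

theorem r_commute_copy (h : BraidedSeq f f' r x N) {i l : ℕ} (hi : i + 1 < N) (hl : i + 2 ≤ l) :
    Commute (r i) (seqCopy f f' x l) :=
  h.commute_copy_of_add_two_le (h.compat' i hi) (h.r_commute_copy_of_lt (by omega))
    (fun j hj => h.comm_rf i j hj) hl

/-- Conjugation with `f 0 * ⋯ * f (n - 1)` moves the braiding by one factor. -/
theorem seqProd_semiconj_f (h : BraidedSeq f f' r x N) {i n : ℕ} (hi : i + 2 ≤ n) (hn : n ≤ N) :
    SemiconjBy (seqProd f n) (f i) (f (i + 1)) := by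
  induction n, hi using Nat.le_induction with
  | base =>
    rw [seqProd, seqProd, mul_assoc]
    exact SemiconjBy.mul_left (seqProd_commute i fun j hj => h.comm_ff j _ (by omega))
      (h.braid i (by omega))
  | succ n hi ih => exact (ih (by omega)).mul_left (h.comm_ff i n hi).symm

theorem seqProd_semiconj_r (h : BraidedSeq f f' r x N) {i n : ℕ} (hi : i + 2 ≤ n) (hn : n ≤ N) :
    SemiconjBy (seqProd f n) (r i) (r (i + 1)) := by
  induction n, hi using Nat.le_induction with
  | base =>
    rw [seqProd, seqProd, mul_assoc]
    exact SemiconjBy.mul_left (seqProd_commute i fun j hj => h.comm_fr j _ (by omega))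
      (h.compat i (by omega))
  | succ n hi ih => exact (ih (by omega)).mul_left (h.comm_rf i n hi).symm

theorem seqProd_semiconj_copy (h : BraidedSeq f f' r x N) {i n : ℕ} (hi : i + 1 ≤ n)
    (hn : n ≤ N) :
    SemiconjBy (seqProd f n) (seqCopy f f' x i) (seqCopy f f' x (i + 1)) := by
  induction n, hi using Nat.le_induction with
  | base =>
    rw [seqProd]
    exact SemiconjBy.mul_left
      (seqProd_commute i fun j hj => h.f_commute_copy (by omega) (by omega)) (h.semiconj_copy i)
  | succ n hi ih => exact (ih (by omega)).mul_left (h.f_commute_copy_of_lt (by omega))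

theorem seqProd_mul_inv (h : BraidedSeq f f' r x N) (n : ℕ) :
    seqProd f n * seqProdInv f' n = 1 := by
  induction n with
  | zero => simp [seqProd, seqProdInv]
  | succ n ih => rw [seqProd, seqProdInv, mul_assoc, ← mul_assoc (f n), h.mul_inv, one_mul, ih]

/-- The relations `r_i x_i x_{i+1} = x_i x_{i+1} r''_i` follow from the one with `i = 0`. -/
theorem r_mul_copy_mul_copy (h : BraidedSeq f f' r x N) {r'' : ℕ → E}
    (hr'' : ∀ i, r'' i = f i * f i * r i * f' i * f' i)
    (h0 : r 0 * seqCopy f f' x 0 * seqCopy f f' x 1 =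
      seqCopy f f' x 0 * seqCopy f f' x 1 * r'' 0) {i : ℕ} (hi : i < N) :
    r i * seqCopy f f' x i * seqCopy f f' x (i + 1) =
      seqCopy f f' x i * seqCopy f f' x (i + 1) * r'' i := by
  induction i with
  | zero => exact h0
  | succ i ih =>
    have hf := h.seqProd_semiconj_f (i := i) (n := N) (by omega) le_rfl
    have hf' : SemiconjBy (seqProd f N) (f' i) (f' (i + 1)) := by
      have h1 := hf.eq
      calc seqProd f N * f' i = f' (i + 1) * (f (i + 1) * seqProd f N) * f' i := by
            rw [← mul_assoc, h.inv_mul, one_mul]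
        _ = f' (i + 1) * seqProd f N := by
            rw [← h1, mul_assoc, mul_assoc, h.mul_inv, mul_one]
    have hr := h.seqProd_semiconj_r (i := i) (n := N) (by omega) le_rfl
    have hc := h.seqProd_semiconj_copy (i := i) (n := N) (by omega) le_rfl
    have hc' := h.seqProd_semiconj_copy (i := i + 1) (n := N) (by omega) le_rfl
    have hr2 : SemiconjBy (seqProd f N) (r'' i) (r'' (i + 1)) := by
      rw [hr'', hr'']
      exact (((hf.mul_right hf).mul_right hr).mul_right hf').mul_right hf'
    have e1 := ((hr.mul_right hc).mul_right hc').eq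
    have e2 := ((hc.mul_right hc').mul_right hr2).eq
    rw [ih (by omega), e2] at e1
    have := congrArg (· * seqProdInv f' N) e1
    simpa only [mul_assoc, h.seqProd_mul_inv, mul_one] using this.symm

/-- The generators `r_i` pass through a product of copies, turning into `r''_i`. -/
theorem r_mul_copyRange (h : BraidedSeq f f' r x N) {r'' : ℕ → E}
    (hr'' : ∀ i, r'' i = f i * f i * r i * f' i * f' i)
    (h0 : r 0 * seqCopy f f' x 0 * seqCopy f f' x 1 =
      seqCopy f f' x 0 * seqCopy f f' x 1 * r'' 0) {i k : ℕ} (hi : i + 2 ≤ k) (hk : k ≤ N + 1) :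
    r i * copyRange (seqCopy f f' x) 0 k = copyRange (seqCopy f f' x) 0 k * r'' i := by
  induction k, hi using Nat.le_induction with
  | base =>
    have h1 : Commute (r i) (copyRange (seqCopy f f' x) 0 i) := by
      have (l : ℕ) (hl : l ≤ i) : Commute (r i) (copyRange (seqCopy f f' x) 0 l) := by
        induction l with
        | zero => exact Commute.one_right _
        | succ l ih =>
          rw [copyRange, zero_add]
          exact (ih (by omega)).mul_right (h.r_commute_copy_of_lt (by omega))
      exact this i le_rfl
    have h2 := h.r_mul_copy_mul_copy hr'' h0 (i := i) (by omega)
    simp only [copyRange, zero_add]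
    rw [← mul_assoc, ← mul_assoc, h1.eq, mul_assoc, mul_assoc, ← mul_assoc (r i), h2]
    simp only [mul_assoc]
  | succ k hi ih =>
    have h1 : Commute (r'' i) (seqCopy f f' x k) := by
      have hf := h.f_commute_copy (i := i) (l := k) (by omega) hi
      have hf' := semiconj_inv_left (h.inv_mul i) (h.mul_inv i) hf
      have hr := h.r_commute_copy (i := i) (l := k) (by omega) hi
      rw [hr'']
      exact (((hf.mul_left hf).mul_left hr).mul_left hf').mul_left hf'
    rw [copyRange, zero_add, ← mul_assoc, ih (by omega), mul_assoc, h1.eq, mul_assoc]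

end BraidedSeq

end BraidedCopies

/-! ### Operators on tensor powers -/

section TensorLegs

variable {ι : Type*}

theorem sum_snoc [Fintype ι] {A : Type*} [AddCommMonoid A] {m : ℕ} (g : (Fin (m + 1) → ι) → A) :
    ∑ c, g c = ∑ c : Fin m → ι, ∑ x : ι, g (Fin.snoc (α := fun _ => ι) c x) := by
  rw [← (Fin.snocEquiv fun _ => ι).sum_comp g, Fintype.sum_prod_type_right]
  rfl

theorem sum_cons [Fintype ι] {A : Type*} [AddCommMonoid A] {m : ℕ} (g : (Fin (m + 1) → ι) → A) :
    ∑ c, g c = ∑ x : ι, ∑ c : Fin m → ι, g (Fin.cons (α := fun _ => ι) x c) := by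
  rw [← (Fin.consEquiv fun _ => ι).sum_comp g, Fintype.sum_prod_type]
  rfl

theorem snoc_surj {m : ℕ} (a : Fin (m + 1) → ι) :
    ∃ (c : Fin m → ι) (x : ι), Fin.snoc (α := fun _ => ι) c x = a :=
  ⟨_, _, Fin.snoc_init_self a⟩

theorem cons_surj {m : ℕ} (a : Fin (m + 1) → ι) :
    ∃ (x : ι) (c : Fin m → ι), Fin.cons (α := fun _ => ι) x c = a :=
  ⟨_, _, Fin.cons_self_tail a⟩

end TensorLegs

section IteratedSums

variable {ι A : Type*} [Fintype ι] [AddCommMonoid A]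

theorem sum_fin_four (g : (Fin 4 → ι) → A) :
    ∑ c, g c = ∑ w, ∑ x, ∑ y, ∑ z, g ![w, x, y, z] := by
  simp only [sum_cons, Fintype.sum_unique]
  refine Finset.sum_congr rfl fun w _ => Finset.sum_congr rfl fun x _ =>
    Finset.sum_congr rfl fun y _ => Finset.sum_congr rfl fun z _ => congrArg g ?_
  funext i
  fin_cases i <;> rfl

theorem sum_comm_pair (f : ι → ι → ι → ι → A) :
    ∑ a, ∑ b, ∑ c, ∑ d, f a b c d = ∑ c, ∑ d, ∑ a, ∑ b, f a b c d := by
  simpa only [Fintype.sum_prod_type] using Finset.sum_comm (s := Finset.univ) (t := Finset.univ)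
    (f := fun p r : ι × ι => f p.1 p.2 r.1 r.2)

theorem sum_comm_left (f : ι → ι → ι → A) :
    ∑ a, ∑ b, ∑ c, f a b c = ∑ c, ∑ a, ∑ b, f a b c :=
  (Finset.sum_congr rfl fun _ _ => Finset.sum_comm).trans Finset.sum_comm

theorem sum_comm_crossing (f : ι → ι → ι → ι → ι → ι → ι → ι → A) :
    ∑ x, ∑ y, ∑ u, ∑ v, ∑ c, ∑ d, ∑ e, ∑ g, f x y u v c d e g =
      ∑ c, ∑ g, ∑ u, ∑ d, ∑ e, ∑ x, ∑ v, ∑ y, f x y u v c d e g := by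
  calc _ = ∑ x, ∑ y, ∑ u, ∑ v, ∑ c, ∑ g, ∑ d, ∑ e, f x y u v c d e g :=
        Finset.sum_congr rfl fun x _ => Finset.sum_congr rfl fun y _ =>
          Finset.sum_congr rfl fun u _ => Finset.sum_congr rfl fun v _ =>
          Finset.sum_congr rfl fun c _ => sum_comm_left fun d e g => f x y u v c d e g
    _ = ∑ x, ∑ y, ∑ c, ∑ g, ∑ u, ∑ v, ∑ d, ∑ e, f x y u v c d e g :=
        Finset.sum_congr rfl fun x _ => Finset.sum_congr rfl fun y _ =>
          sum_comm_pair fun u v c g => ∑ d, ∑ e, f x y u v c d e g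
    _ = ∑ c, ∑ g, ∑ x, ∑ y, ∑ u, ∑ v, ∑ d, ∑ e, f x y u v c d e g :=
        sum_comm_pair fun x y c g => ∑ u, ∑ v, ∑ d, ∑ e, f x y u v c d e g
    _ = ∑ c, ∑ g, ∑ u, ∑ d, ∑ e, ∑ x, ∑ v, ∑ y, f x y u v c d e g := by
        refine Finset.sum_congr rfl fun c _ => Finset.sum_congr rfl fun g _ => ?_
        calc _ = ∑ u, ∑ x, ∑ y, ∑ v, ∑ d, ∑ e, f x y u v c d e g :=
              sum_comm_left fun x y u => ∑ v, ∑ d, ∑ e, f x y u v c d e g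
          _ = ∑ u, ∑ x, ∑ d, ∑ e, ∑ y, ∑ v, f x y u v c d e g :=
              Finset.sum_congr rfl fun u _ => Finset.sum_congr rfl fun x _ =>
                sum_comm_pair fun y v d e => f x y u v c d e g
          _ = ∑ u, ∑ d, ∑ e, ∑ x, ∑ y, ∑ v, f x y u v c d e g :=
              Finset.sum_congr rfl fun u _ =>
                (sum_comm_left fun d e x => ∑ y, ∑ v, f x y u v c d e g).symm
          _ = _ :=
              Finset.sum_congr rfl fun u _ => Finset.sum_congr rfl fun d _ =>
                Finset.sum_congr rfl fun e _ => Finset.sum_congr rfl fun x _ => Finset.sum_comm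

end IteratedSums

section SiteEntries

variable {K ι B : Type*} [Field K] [Ring B] [DecidableEq ι]

theorem site_of_le (X : Matrix (ι × ι) (ι × ι) K) {m i : ℕ} (h : m ≤ i + 1) :
    site X m i = 1 := by
  rw [site, dif_neg (by omega)]

theorem site_zero_cons (X : Matrix (ι × ι) (ι × ι) K) {m : ℕ} (a b : Fin m → ι) (x y x' y' : ι) :
    site X (m + 2) 0 (Fin.cons (α := fun _ => ι) x (Fin.cons (α := fun _ => ι) y a))
      (Fin.cons (α := fun _ => ι) x' (Fin.cons (α := fun _ => ι) y' b)) =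
      if a = b then X (x, y) (x', y') else 0 := by
  rw [site, dif_pos (by omega)]
  simp [Fin.forall_fin_succ, funext_iff]

theorem firstSite_cons (M : Matrix ι ι B) {m : ℕ} (a b : Fin m → ι) (x y : ι) :
    firstSite M (m + 1) (Fin.cons (α := fun _ => ι) x a) (Fin.cons (α := fun _ => ι) y b) =
      if a = b then M x y else 0 := by
  rw [firstSite, dif_pos (by omega)]
  simp [Fin.forall_fin_succ, funext_iff]

theorem site_last_snoc (X : Matrix (ι × ι) (ι × ι) K) {m : ℕ} (a b : Fin m → ι)
    (x y x' y' : ι) :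
    site X (m + 2) m (Fin.snoc (α := fun _ => ι) (Fin.snoc (α := fun _ => ι) a x) y)
      (Fin.snoc (α := fun _ => ι) (Fin.snoc (α := fun _ => ι) b x') y') =
      if a = b then X (x, y) (x', y') else 0 := by
  have h1 (c : Fin m → ι) (z w : ι) : Fin.snoc (α := fun _ => ι)
      (Fin.snoc (α := fun _ => ι) c z) w (⟨m, by omega⟩ : Fin (m + 2)) = z := by
    have := Fin.snoc_castSucc (α := fun _ => ι) w (Fin.snoc (α := fun _ => ι) c z) (Fin.last m)
    rw [Fin.snoc_last] at this
    exact this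
  have h2 (c : Fin m → ι) (z w : ι) : Fin.snoc (α := fun _ => ι)
      (Fin.snoc (α := fun _ => ι) c z) w (⟨m + 1, by omega⟩ : Fin (m + 2)) = w :=
    Fin.snoc_last (α := fun _ => ι) w (Fin.snoc (α := fun _ => ι) c z)
  rw [site, dif_pos (by omega)]
  simp only [Matrix.of_apply, h1, h2]
  congr 1
  simp only [Fin.forall_fin_succ', Fin.snoc_castSucc, Fin.snoc_last, Fin.val_castSucc,
    Fin.val_last, funext_iff, eq_iff_iff]
  have h3 (i : Fin m) : (i : ℕ) ≠ m := i.2.ne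
  have h4 (i : Fin m) : (i : ℕ) ≠ m + 1 := by have := i.2; omega
  simp [h3, h4]

theorem site_four_zero (X : Matrix (ι × ι) (ι × ι) K) (w x y z w' x' y' z' : ι) :
    site X 4 0 ![w, x, y, z] ![w', x', y', z'] =
      if y = y' then if z = z' then X (w, x) (w', x') else 0 else 0 := by
  rw [← ite_and]
  simp only [site, Nat.reduceAdd, Nat.reduceLT, dite_true, Matrix.of_apply]
  congr 1
  simp [Fin.forall_fin_succ]

theorem site_four_one (X : Matrix (ι × ι) (ι × ι) K) (w x y z w' x' y' z' : ι) :
    site X 4 1 ![w, x, y, z] ![w', x', y', z'] =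
      if w = w' then if z = z' then X (x, y) (x', y') else 0 else 0 := by
  rw [← ite_and]
  simp only [site, Nat.reduceAdd, Nat.reduceLT, dite_true, Matrix.of_apply]
  congr 1
  simp [Fin.forall_fin_succ]

theorem site_four_two (X : Matrix (ι × ι) (ι × ι) K) (w x y z w' x' y' z' : ι) :
    site X 4 2 ![w, x, y, z] ![w', x', y', z'] =
      if w = w' then if x = x' then X (y, z) (y', z') else 0 else 0 := by
  rw [← ite_and]
  simp only [site, Nat.reduceAdd, Nat.reduceLT, dite_true, Matrix.of_apply]
  congr 1
  simp [Fin.forall_fin_succ]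

end SiteEntries

section AddingLegs

variable (K : Type*) {ι B : Type*} [Field K] [Ring B] [Algebra K B] [Fintype ι] [DecidableEq ι]

/-- The operator `X ⊗ 1` on `V^{⊗ (m+1)}`, for an operator `X` on `V^{⊗ m}`. -/
def addLeg {m : ℕ} :
    Matrix (Fin m → ι) (Fin m → ι) B →ₐ[K] Matrix (Fin (m + 1) → ι) (Fin (m + 1) → ι) B :=
  AlgHom.ofLinearMap
    { toFun X := Matrix.of fun a b =>
        if a (Fin.last m) = b (Fin.last m) then X (Fin.init a) (Fin.init b) else 0
      map_add' X Y := by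
        ext a b
        simp only [Matrix.of_apply, Matrix.add_apply]
        split_ifs <;> simp
      map_smul' c X := by
        ext a b
        simp only [Matrix.of_apply, Matrix.smul_apply, RingHom.id_apply]
        split_ifs <;> simp }
    (by
      ext a b
      obtain ⟨a, x, rfl⟩ := snoc_surj a
      obtain ⟨b, y, rfl⟩ := snoc_surj b
      simp only [LinearMap.coe_mk, AddHom.coe_mk, Matrix.of_apply, Matrix.one_apply,
        Fin.snoc_last, Fin.init_snoc, Fin.snoc_inj]
      split_ifs <;> simp_all)
    (by
      intro X Y
      ext a b
      obtain ⟨a, x, rfl⟩ := snoc_surj a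
      obtain ⟨b, y, rfl⟩ := snoc_surj b
      simp only [LinearMap.coe_mk, AddHom.coe_mk, Matrix.of_apply, Matrix.mul_apply, sum_snoc,
        Fin.snoc_last, Fin.init_snoc]
      split_ifs with h <;> simp [h])

/-- The operator `1 ⊗ X` on `V^{⊗ (m+1)}`, for an operator `X` on `V^{⊗ m}`. -/
def consLeg {m : ℕ} :
    Matrix (Fin m → ι) (Fin m → ι) B →ₐ[K] Matrix (Fin (m + 1) → ι) (Fin (m + 1) → ι) B :=
  AlgHom.ofLinearMap
    { toFun X := Matrix.of fun a b => if a 0 = b 0 then X (Fin.tail a) (Fin.tail b) else 0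
      map_add' X Y := by
        ext a b
        simp only [Matrix.of_apply, Matrix.add_apply]
        split_ifs <;> simp
      map_smul' c X := by
        ext a b
        simp only [Matrix.of_apply, Matrix.smul_apply, RingHom.id_apply]
        split_ifs <;> simp }
    (by
      ext a b
      obtain ⟨x, a, rfl⟩ := cons_surj a
      obtain ⟨y, b, rfl⟩ := cons_surj b
      simp only [LinearMap.coe_mk, AddHom.coe_mk, Matrix.of_apply, Matrix.one_apply,
        Fin.cons_zero, Fin.tail_cons, Fin.cons_inj]
      split_ifs <;> simp_all)
    (by
      intro X Y
      ext a b
      obtain ⟨x, a, rfl⟩ := cons_surj a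
      obtain ⟨y, b, rfl⟩ := cons_surj b
      simp only [LinearMap.coe_mk, AddHom.coe_mk, Matrix.of_apply, Matrix.mul_apply, sum_cons,
        Fin.cons_zero, Fin.tail_cons]
      rw [Finset.sum_comm]
      split_ifs with h <;> simp [h])

variable {K}

theorem addLeg_snoc {m : ℕ} (X : Matrix (Fin m → ι) (Fin m → ι) B) (a b : Fin m → ι) (x y : ι) :
    addLeg K X (Fin.snoc (α := fun _ => ι) a x) (Fin.snoc (α := fun _ => ι) b y) =
      if x = y then X a b else 0 := by
  simp [addLeg]

theorem consLeg_cons {m : ℕ} (X : Matrix (Fin m → ι) (Fin m → ι) B) (a b : Fin m → ι) (x y : ι) :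
    consLeg K X (Fin.cons (α := fun _ => ι) x a) (Fin.cons (α := fun _ => ι) y b) =
      if x = y then X a b else 0 := by
  simp [consLeg]

theorem scalarMap_mul {κ : Type*} [Fintype κ] (X Y : Matrix κ κ K) :
    scalarMap B (X * Y) = scalarMap B X * scalarMap B Y :=
  Matrix.map_mul

theorem scalarMap_one {κ : Type*} [DecidableEq κ] :
    scalarMap B (1 : Matrix κ κ K) = 1 :=
  Matrix.map_one _ (map_zero _) (map_one _)

theorem scalarMap_addLeg {m : ℕ} (X : Matrix (Fin m → ι) (Fin m → ι) K) :
    scalarMap B (addLeg K X) = addLeg K (scalarMap B X) := by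
  ext a b
  simp only [scalarMap, addLeg, AlgHom.ofLinearMap_apply, LinearMap.coe_mk, AddHom.coe_mk,
    Matrix.map_apply, Matrix.of_apply, apply_ite (algebraMap K B), map_zero]

theorem site_eq_addLeg (X : Matrix (ι × ι) (ι × ι) K) {m i : ℕ} (h : i + 1 < m) :
    site X (m + 1) i = addLeg K (site X m i) := by
  ext a b
  obtain ⟨a, x, rfl⟩ := snoc_surj a
  obtain ⟨b, y, rfl⟩ := snoc_surj b
  have h1 (c : Fin m → ι) (z : ι) (j : ℕ) (hj : j < m) :
      Fin.snoc (α := fun _ => ι) c z (⟨j, by omega⟩ : Fin (m + 1)) = c ⟨j, hj⟩ :=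
    Fin.snoc_castSucc (α := fun _ => ι) z c ⟨j, hj⟩
  rw [addLeg_snoc, site, site, dif_pos (by omega), dif_pos h]
  have h2 : m ≠ i := by omega
  have h3 : m ≠ i + 1 := by omega
  simp only [Matrix.of_apply, Fin.forall_fin_succ', Fin.snoc_castSucc, Fin.snoc_last,
    Fin.val_castSucc, Fin.val_last, h2, h3, ne_eq, not_false_eq_true, forall_const]
  rw [h1 a x i (by omega), h1 a x (i + 1) h, h1 b y i (by omega), h1 b y (i + 1) h]
  split_ifs <;> simp_all

theorem site_eq_consLeg (X : Matrix (ι × ι) (ι × ι) K) (m i : ℕ) :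
    site X (m + 1) (i + 1) = consLeg K (site X m i) := by
  by_cases h : i + 1 < m
  · ext a b
    obtain ⟨x, a, rfl⟩ := cons_surj a
    obtain ⟨y, b, rfl⟩ := cons_surj b
    have h1 (c : Fin m → ι) (z : ι) (j : ℕ) (hj : j < m) :
        Fin.cons (α := fun _ => ι) z c (⟨j + 1, by omega⟩ : Fin (m + 1)) = c ⟨j, hj⟩ :=
      Fin.cons_succ (α := fun _ => ι) z c ⟨j, hj⟩
    rw [consLeg_cons, site, site, dif_pos (by omega), dif_pos h]
    simp only [Matrix.of_apply, Fin.forall_fin_succ, Fin.cons_succ, Fin.cons_zero,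
      Fin.val_succ, Fin.val_zero, ne_eq, Nat.add_right_cancel_iff]
    rw [h1 a x i (by omega), h1 a x (i + 1) h, h1 b y i (by omega), h1 b y (i + 1) h]
    split_ifs <;> simp_all
  · rw [site, site, dif_neg (by omega), dif_neg h, map_one]

/-- The operators in `n` adjacent tensor factors are embedded into those in `m` factors. -/
theorem exists_embedding {i n m : ℕ} (h : i + n ≤ m) :
    ∃ g : Matrix (Fin n → ι) (Fin n → ι) K →ₐ[K] Matrix (Fin m → ι) (Fin m → ι) K,
      ∀ (X : Matrix (ι × ι) (ι × ι) K) (j : ℕ), j + 1 < n →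
        site X m (i + j) = g (site X n j) := by
  induction i generalizing m with
  | zero =>
    rw [zero_add] at h
    induction m, h using Nat.le_induction with
    | base => exact ⟨AlgHom.id K _, fun X j _ => by simp⟩
    | succ m h ih =>
      obtain ⟨g, hg⟩ := ih
      refine ⟨(addLeg K).comp g, fun X j hj => ?_⟩
      rw [site_eq_addLeg X (by omega), hg X j hj]
      rfl
  | succ i ih =>
    obtain ⟨m, rfl⟩ : ∃ m', m = m' + 1 := ⟨m - 1, by omega⟩
    obtain ⟨g, hg⟩ := ih (m := m) (by omega)
    refine ⟨(consLeg K).comp g, fun X j hj => ?_⟩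
    rw [show i + 1 + j = i + j + 1 by omega, site_eq_consLeg, hg X j hj]
    rfl

/-- The operators on `V ⊗ V` as operators on `V^{⊗ m}` for `m = 2`. -/
theorem site_two (X : Matrix (ι × ι) (ι × ι) K) :
    site X 2 0 = Matrix.reindexAlgEquiv K K (finTwoArrowEquiv ι).symm X := by
  ext a b
  simp [site]

theorem exists_site_hom {m i : ℕ} (h : i + 1 < m) :
    ∃ g : Matrix (ι × ι) (ι × ι) K →ₐ[K] Matrix (Fin m → ι) (Fin m → ι) K,
      ∀ X, site X m i = g X := by
  obtain ⟨g, hg⟩ := exists_embedding (K := K) (ι := ι) (i := i) (n := 2) (m := m) (by omega)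
  refine ⟨g.comp (Matrix.reindexAlgEquiv K K (finTwoArrowEquiv ι).symm).toAlgHom, fun X => ?_⟩
  rw [← add_zero i, hg X 0 (by omega), site_two]
  rfl

theorem site_mul (X Y : Matrix (ι × ι) (ι × ι) K) (m i : ℕ) :
    site (X * Y) m i = site X m i * site Y m i := by
  by_cases h : i + 1 < m
  · obtain ⟨g, hg⟩ := exists_site_hom (K := K) (ι := ι) h
    simp only [hg, map_mul]
  · simp [site_of_le _ (not_lt.1 h)]

theorem site_one (m i : ℕ) : site (1 : Matrix (ι × ι) (ι × ι) K) m i = 1 := by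
  by_cases h : i + 1 < m
  · obtain ⟨g, hg⟩ := exists_site_hom (K := K) (ι := ι) h
    simp only [hg, map_one]
  · simp [site_of_le _ (not_lt.1 h)]

theorem site_hecke {q : K} {R : Matrix (ι × ι) (ι × ι) K} (hR : R * R = 1 + (q - q⁻¹) • R)
    {m i : ℕ} (h : i + 1 < m) :
    site R m i * site R m i = 1 + (q - q⁻¹) • site R m i := by
  obtain ⟨g, hg⟩ := exists_site_hom (K := K) (ι := ι) h
  simp only [hg, ← map_mul, hR, map_add, map_one, map_smul]

theorem site_rel {X Y Z X' Y' Z' : Matrix (ι × ι) (ι × ι) K}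
    (h : site X 3 0 * site Y 3 1 * site Z 3 0 = site X' 3 1 * site Y' 3 0 * site Z' 3 1)
    {m i : ℕ} (hi : i + 2 < m) :
    site X m i * site Y m (i + 1) * site Z m i =
      site X' m (i + 1) * site Y' m i * site Z' m (i + 1) := by
  obtain ⟨g, hg⟩ := exists_embedding (K := K) (ι := ι) (i := i) (n := 3) (m := m) (by omega)
  have h0 (X : Matrix (ι × ι) (ι × ι) K) : site X m i = g (site X 3 0) := hg X 0 (by omega)
  have h1 (X : Matrix (ι × ι) (ι × ι) K) : site X m (i + 1) = g (site X 3 1) := hg X 1 (by omega)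
  simp only [h0, h1, ← map_mul, h]

theorem site_commute (X Y : Matrix (ι × ι) (ι × ι) K) (m : ℕ) {i j : ℕ} (h : i + 2 ≤ j) :
    Commute (site X m i) (site Y m j) := by
  induction i generalizing m j with
  | zero =>
    obtain ⟨j, rfl⟩ := Nat.exists_eq_add_of_le' h
    by_cases hm : m < 2
    · rw [site_of_le X (by omega)]
      exact Commute.one_left _
    · obtain ⟨m, rfl⟩ := Nat.exists_eq_add_of_le' (not_lt.1 hm)
      rw [show j + (0 + 2) = j + 1 + 1 by omega, site_eq_consLeg, site_eq_consLeg]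
      ext a b
      obtain ⟨x, a, rfl⟩ := cons_surj a
      obtain ⟨x', b, rfl⟩ := cons_surj b
      obtain ⟨y, a, rfl⟩ := cons_surj a
      obtain ⟨y', b, rfl⟩ := cons_surj b
      simp [Matrix.mul_apply, sum_cons, site_zero_cons, consLeg_cons, mul_comm]
  | succ i ih =>
    obtain ⟨j, rfl⟩ : ∃ j', j = j' + 1 := ⟨j - 1, by omega⟩
    rcases m with _ | m
    · rw [site_of_le X (by omega)]
      exact Commute.one_left _
    · rw [site_eq_consLeg, site_eq_consLeg]
      exact (ih m (by omega)).map (consLeg K)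

theorem firstSite_eq_addLeg (M : Matrix ι ι B) {m : ℕ} (h : 0 < m) :
    firstSite M (m + 1) = addLeg K (firstSite M m) := by
  ext a b
  obtain ⟨a, x, rfl⟩ := snoc_surj a
  obtain ⟨b, y, rfl⟩ := snoc_surj b
  have h1 (c : Fin m → ι) (z : ι) :
      Fin.snoc (α := fun _ => ι) c z (⟨0, by omega⟩ : Fin (m + 1)) = c ⟨0, h⟩ :=
    Fin.snoc_castSucc (α := fun _ => ι) z c ⟨0, h⟩
  rw [addLeg_snoc, firstSite, firstSite, dif_pos (by omega), dif_pos h]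
  have h2 : m ≠ 0 := by omega
  simp only [Matrix.of_apply, Fin.forall_fin_succ', Fin.snoc_castSucc, Fin.snoc_last,
    Fin.val_castSucc, Fin.val_last, h2, ne_eq, not_false_eq_true, forall_const]
  rw [h1 a x, h1 b y]
  split_ifs <;> simp_all

theorem firstSite_commute (M : Matrix ι ι B) (X : Matrix (ι × ι) (ι × ι) K) (m i : ℕ) :
    Commute (scalarMap B (site X m (i + 1))) (firstSite M m) := by
  rcases m with _ | m
  · rw [site_of_le X (by omega), scalarMap_one]
    exact Commute.one_left _
  · rw [site_eq_consLeg]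
    ext a b
    obtain ⟨x, a, rfl⟩ := cons_surj a
    obtain ⟨y, b, rfl⟩ := cons_surj b
    simp [Matrix.mul_apply, sum_cons, firstSite_cons, scalarMap, consLeg_cons, Algebra.commutes,
      apply_ite (algebraMap K B)]

end AddingLegs

/-! ### The matrix `D` and partial quantum traces -/

section SkewInverse

variable {K ι : Type*} [Field K] [Fintype ι] [DecidableEq ι] {F Ψ : Matrix (ι × ι) (ι × ι) K}

theorem IsSkewInverse.mul_skewTranspose (h : IsSkewInverse F Ψ) :
    (Matrix.of fun x y : ι × ι => Ψ (x.1, y.1) (x.2, y.2)) * skewTranspose F = 1 := by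
  ext ⟨a, c⟩ ⟨d, b⟩
  have := h a b c d
  simp only [Matrix.mul_apply, Fintype.sum_prod_type, Matrix.of_apply, skewTranspose, this,
    Matrix.one_apply, Prod.mk.injEq]
  congr 1
  simp [eq_comm]

/-- Contraction with `F` over the second factor is injective. -/
theorem IsSkewInverse.cancel (h : IsSkewInverse F Ψ) {v w : ι → ι → K}
    (hvw : ∀ g f, ∑ b, ∑ d, F (g, b) (f, d) * v b d = ∑ b, ∑ d, F (g, b) (f, d) * w b d)
    (b d : ι) : v b d = w b d := by
  have h1 : (skewTranspose F).mulVec (fun p => v p.2 p.1) =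
      (skewTranspose F).mulVec (fun p => w p.2 p.1) := by
    funext ⟨f, g⟩
    have := hvw g f
    simp only [Matrix.mulVec, dotProduct, Fintype.sum_prod_type_right, skewTranspose,
      Matrix.of_apply]
    exact this
  have h2 := congrArg (Matrix.mulVec (Matrix.of fun x y : ι × ι => Ψ (x.1, y.1) (x.2, y.2))) h1
  rw [Matrix.mulVec_mulVec, Matrix.mulVec_mulVec, h.mul_skewTranspose, Matrix.one_mulVec,
    Matrix.one_mulVec] at h2
  exact congrFun h2 (d, b)

/-- The quantum trace of `F` over its second factor is the identity. -/
theorem IsSkewInverse.sum_mul_dMatrix (h : IsSkewInverse F Ψ) (a b : ι) :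
    ∑ u, ∑ w, F (a, u) (b, w) * dMatrix F w u = if a = b then 1 else 0 := by
  have h1 (f g f' g' : ι) :
      ∑ w, ∑ u, F (g, u) (f, w) * Ψ (w, f') (u, g') = if f = f' ∧ g = g' then 1 else 0 := by
    have h2 := mul_eq_one_comm.1 h.mul_skewTranspose
    have := congrFun (congrFun h2 (f, g)) (f', g')
    simpa only [Matrix.mul_apply, Fintype.sum_prod_type, Matrix.of_apply, skewTranspose,
      Matrix.one_apply, Prod.mk.injEq] using this
  simp only [dMatrix, ← h.eq_skewInverse, Matrix.of_apply, Finset.mul_sum]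
  rw [Finset.sum_comm]
  rw [Finset.sum_congr rfl fun w _ => Finset.sum_comm, Finset.sum_comm]
  simp only [h1]
  by_cases hab : a = b
  · simp [hab]
  · rw [if_neg hab]
    refine Finset.sum_eq_zero fun c _ => if_neg ?_
    rintro ⟨rfl, rfl⟩
    exact hab rfl

end SkewInverse

section PartialTrace

variable {K ι B : Type*} [Field K] [Fintype ι] [DecidableEq ι] [Ring B] [Algebra K B]
  {F : Matrix (ι × ι) (ι × ι) K}

/-- The quantum trace over the last factor of `V^{⊗ (m+1)}`. -/
noncomputable def ptr (F : Matrix (ι × ι) (ι × ι) K) {m : ℕ}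
    (Z : Matrix (Fin (m + 1) → ι) (Fin (m + 1) → ι) B) : Matrix (Fin m → ι) (Fin m → ι) B :=
  Matrix.of fun a b => ∑ x, ∑ y, dMatrix F x y •
    Z (Fin.snoc (α := fun _ => ι) a y) (Fin.snoc (α := fun _ => ι) b x)

/-- The operator `D ⊗ ⋯ ⊗ D`. -/
noncomputable def dPow (F : Matrix (ι × ι) (ι × ι) K) (m : ℕ) :
    Matrix (Fin m → ι) (Fin m → ι) K :=
  Matrix.of fun a b : Fin m → ι => ∏ l, dMatrix F (a l) (b l)

theorem qTrace_eq_sum {m : ℕ} (Z : Matrix (Fin m → ι) (Fin m → ι) B) :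
    qTrace F m Z = ∑ a, ∑ b, dPow F m a b • Z b a := by
  simp [qTrace, Matrix.trace, Matrix.mul_apply, scalarMap, dPow, Algebra.smul_def]

theorem dPow_snoc {m : ℕ} (a b : Fin m → ι) (x y : ι) :
    dPow F (m + 1) (Fin.snoc (α := fun _ => ι) a x) (Fin.snoc (α := fun _ => ι) b y) =
      dPow F m a b * dMatrix F x y := by
  simp [dPow, Fin.prod_univ_castSucc]

theorem dPow_cons {m : ℕ} (a b : Fin m → ι) (x y : ι) :
    dPow F (m + 1) (Fin.cons (α := fun _ => ι) x a) (Fin.cons (α := fun _ => ι) y b) =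
      dMatrix F x y * dPow F m a b := by
  simp [dPow, Fin.prod_univ_succ]

theorem qTrace_ptr {m : ℕ} (Z : Matrix (Fin (m + 1) → ι) (Fin (m + 1) → ι) B) :
    qTrace F m (ptr F Z) = qTrace F (m + 1) Z := by
  simp only [qTrace_eq_sum, sum_snoc, dPow_snoc, ptr, Matrix.of_apply, Finset.smul_sum, smul_smul]
  refine Finset.sum_congr rfl fun a _ => ?_
  rw [Finset.sum_comm]

theorem ptr_addLeg_mul {m : ℕ} (U : Matrix (Fin m → ι) (Fin m → ι) B)
    (Z : Matrix (Fin (m + 1) → ι) (Fin (m + 1) → ι) B) :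
    ptr F (addLeg K U * Z) = U * ptr F Z := by
  ext a b
  simp only [ptr, Matrix.of_apply, Matrix.mul_apply, sum_snoc, addLeg_snoc, ite_mul, zero_mul,
    Finset.sum_ite_eq, Finset.mem_univ, if_true, Finset.smul_sum, Finset.mul_sum, mul_smul_comm]
  exact (Finset.sum_congr rfl fun x _ => Finset.sum_comm).trans Finset.sum_comm

theorem ptr_mul_addLeg {m : ℕ} (U : Matrix (Fin m → ι) (Fin m → ι) B)
    (Z : Matrix (Fin (m + 1) → ι) (Fin (m + 1) → ι) B) :
    ptr F (Z * addLeg K U) = ptr F Z * U := by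
  ext a b
  simp only [ptr, Matrix.of_apply, Matrix.mul_apply, sum_snoc, addLeg_snoc, mul_ite, mul_zero,
    Finset.sum_ite_eq', Finset.mem_univ, if_true, Finset.smul_sum, Finset.sum_mul, smul_mul_assoc]
  exact (Finset.sum_congr rfl fun x _ => Finset.sum_comm).trans Finset.sum_comm

theorem ptr_site_last (hF : IsClosedRMatrix F) (m : ℕ) :
    ptr F (site F (m + 2) m) = 1 := by
  obtain ⟨Ψ, hΨ⟩ := hF.skewInvertible
  ext a b
  obtain ⟨a, x, rfl⟩ := snoc_surj a
  obtain ⟨b, y, rfl⟩ := snoc_surj b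
  have h := hΨ.sum_mul_dMatrix x y
  rw [Finset.sum_comm] at h
  simp only [ptr, Matrix.of_apply, site_last_snoc, Matrix.one_apply, Fin.snoc_inj, smul_eq_mul]
  by_cases hab : a = b
  · simp only [hab, if_true, true_and, ← h, mul_comm]
  · simp [hab]

/-- The matrix elements of the partial quantum trace of a conjugate by `F`. -/
theorem ptr_conj_apply {m : ℕ} (G : Matrix (ι × ι) (ι × ι) K)
    (Y : Matrix (Fin (m + 1) → ι) (Fin (m + 1) → ι) B)
    (a b : Fin m → ι) (s t : ι) :
    ptr F (scalarMap B (site F (m + 2) m) * addLeg K Y * scalarMap B (site G (m + 2) m))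
      (Fin.snoc (α := fun _ => ι) a s) (Fin.snoc (α := fun _ => ι) b t) =
    ∑ u, ∑ w, (∑ x, ∑ y, ∑ v, dMatrix F x y * F (s, y) (u, v) * G (w, v) (t, x)) •
      Y (Fin.snoc (α := fun _ => ι) a u) (Fin.snoc (α := fun _ => ι) b w) := by
  simp only [ptr, Matrix.of_apply, Matrix.mul_apply, sum_snoc, scalarMap, Matrix.map_apply,
    site_last_snoc, addLeg_snoc, apply_ite (algebraMap K B), map_zero, ite_mul, zero_mul, mul_ite,
    mul_zero, Finset.sum_ite_irrel, Finset.sum_const_zero, Finset.sum_ite_eq, Finset.sum_ite_eq',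
    Finset.mem_univ, if_true]
  have h1 (c : K) (z : B) : z * algebraMap K B c = c • z := by
    rw [← Algebra.commutes, Algebra.smul_def]
  have h2 (x y u w v : ι) (z : B) : (dMatrix F x y * F (s, y) (u, v) * G (w, v) (t, x)) • z =
      dMatrix F x y • ((algebraMap K B (F (s, y) (u, v)) * z) *
        algebraMap K B (G (w, v) (t, x))) := by
    rw [h1, ← Algebra.smul_def, smul_smul, smul_smul]
    congr 1
    ring
  simp only [Finset.sum_smul, Finset.smul_sum, Finset.sum_mul, h2]
  calc _ = ∑ x, ∑ y, ∑ u, ∑ w, ∑ v, dMatrix F x y •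
          ((algebraMap K B (F (s, y) (u, v)) * Y (Fin.snoc a u) (Fin.snoc b w)) *
            algebraMap K B (G (w, v) (t, x))) := by
        refine Finset.sum_congr rfl fun x _ => Finset.sum_congr rfl fun y _ => ?_
        exact (Finset.sum_congr rfl fun w _ => Finset.sum_comm).trans Finset.sum_comm
    _ = _ := by
        rw [Finset.sum_congr rfl fun x _ => Finset.sum_comm, Finset.sum_comm]
        refine Finset.sum_congr rfl fun u _ => ?_
        exact (Finset.sum_congr rfl fun x _ => Finset.sum_comm).trans Finset.sum_comm

end PartialTrace

section PartialTraceConj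

variable {K ι B : Type*} [Field K] [Fintype ι] [DecidableEq ι] [Ring B] [Algebra K B]
  {R F : Matrix (ι × ι) (ι × ι) K}

theorem IsRMatrix.mul_inv (h : IsRMatrix F) : F * F⁻¹ = 1 :=
  Matrix.mul_nonsing_inv F ((Matrix.isUnit_iff_isUnit_det F).1 h.isUnit)

theorem IsRMatrix.inv_mul (h : IsRMatrix F) : F⁻¹ * F = 1 :=
  Matrix.nonsing_inv_mul F ((Matrix.isUnit_iff_isUnit_det F).1 h.isUnit)

theorem IsRMatrix.site_mul_inv (h : IsRMatrix F) (m i : ℕ) :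
    site F m i * site F⁻¹ m i = 1 := by
  rw [← site_mul, h.mul_inv, site_one]

theorem IsRMatrix.site_inv_mul (h : IsRMatrix F) (m i : ℕ) :
    site F⁻¹ m i * site F m i = 1 := by
  rw [← site_mul, h.inv_mul, site_one]

/-- The matrix form of `Tr_{F(2)} (F₁ Y₁ F₁⁻¹) = Tr_F(Y) 1`. The quantum trace over the third
factor of `F₁⁻¹ F₂ F₁ = F₂ F₁ F₂⁻¹` is the identity, and the remaining contraction with `F₁` can
be cancelled. -/
theorem sum_conj (hF : IsClosedRMatrix F) (s t u w : ι) :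
    ∑ x, ∑ y, ∑ v, dMatrix F x y * F (s, y) (u, v) * F⁻¹ (w, v) (t, x) =
      if s = t then dMatrix F w u else 0 := by
  obtain ⟨Ψ, hΨ⟩ := hF.skewInvertible
  refine hΨ.cancel (v := fun u w => ∑ x, ∑ y, ∑ v,
    dMatrix F x y * F (s, y) (u, v) * F⁻¹ (w, v) (t, x))
    (w := fun u w => if s = t then dMatrix F w u else 0) (fun g f => ?_) u w
  have h1 : site F 3 1 * site F 3 0 * site F⁻¹ 3 1 = site F⁻¹ 3 0 * site F 3 1 * site F 3 0 := by
    have h2 := hF.isRMatrix.yangBaxter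
    have h3 := hF.isRMatrix.site_inv_mul 3 0
    have h4 := hF.isRMatrix.site_mul_inv 3 1
    calc _ = site F⁻¹ 3 0 * (site F 3 0 * site F 3 1 * site F 3 0) * site F⁻¹ 3 1 := by
          simp only [mul_assoc]
          rw [← mul_assoc (site F⁻¹ 3 0), h3, one_mul]
      _ = site F⁻¹ 3 0 * site F 3 1 * site F 3 0 := by
          rw [h2]
          simp only [mul_assoc, h4, mul_one]
  have h2 : ptr F (site F 3 1 * site F 3 0 * site F⁻¹ 3 1) = 1 := by
    rw [h1, site_eq_addLeg F⁻¹ (by omega : 0 + 1 < 2), site_eq_addLeg F (by omega : 0 + 1 < 2),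
      ptr_mul_addLeg, ptr_addLeg_mul, ptr_site_last hF 1, mul_one, hF.isRMatrix.site_inv_mul]
  have h3 := ptr_conj_apply (F := F) F⁻¹ (site F 2 0) (fun _ : Fin 1 => g) (fun _ => f) s t
  have h4 (X : Matrix (Fin 3 → ι) (Fin 3 → ι) K) : scalarMap K X = X := by
    ext; rfl
  have h5 (u w : ι) : site F 2 0 (Fin.snoc (α := fun _ => ι) (fun _ : Fin 1 => g) u)
      (Fin.snoc (α := fun _ => ι) (fun _ : Fin 1 => f) w) = F (g, u) (f, w) := by
    rw [site, dif_pos (by omega), Matrix.of_apply, if_pos]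
    · rfl
    · intro l h0 h1
      have := l.2
      omega
  rw [h4, h4, ← site_eq_addLeg F (by omega : 0 + 1 < 2)] at h3
  simp only [Nat.reduceAdd, h2, Matrix.one_apply, Fin.snoc_inj, h5, smul_eq_mul] at h3
  calc _ = ∑ u, ∑ w, (∑ x, ∑ y, ∑ v, dMatrix F x y * F (s, y) (u, v) * F⁻¹ (w, v) (t, x)) *
        F (g, u) (f, w) := by simp only [mul_comm]
    _ = _ := by
      rw [← h3]
      by_cases hst : s = t
      · simp only [hst, and_true, if_true, hΨ.sum_mul_dMatrix]
        simp [funext_iff]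
      · simp [hst]

/-- The quantum trace over the last factor of the conjugate by `F` of an operator in the preceding
factors is the quantum trace over the last of the latter. -/
theorem ptr_conj (hF : IsClosedRMatrix F) {m : ℕ}
    (Y : Matrix (Fin (m + 1) → ι) (Fin (m + 1) → ι) B) :
    ptr F (scalarMap B (site F (m + 2) m) * addLeg K Y * scalarMap B (site F⁻¹ (m + 2) m)) =
      addLeg K (ptr F Y) := by
  ext a b
  obtain ⟨a, x, rfl⟩ := snoc_surj a
  obtain ⟨b, y, rfl⟩ := snoc_surj b
  rw [ptr_conj_apply, addLeg_snoc]
  simp only [sum_conj hF, ptr, Matrix.of_apply]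
  split_ifs with h
  · exact Finset.sum_comm
  · simp

/-! ### Cyclicity of the quantum trace -/

open scoped Kronecker

/-- The quantum trace over the last two factors of `X T`, with `X` in these factors, is a
contraction of `T` with `(D ⊗ D) X`. -/
theorem ptr_ptr_site_mul {m : ℕ} (T : Matrix (Fin (m + 2) → ι) (Fin (m + 2) → ι) K)
    (a b : Fin m → ι) :
    ptr F (ptr F (site R (m + 2) m * T)) a b =
      ∑ x, ∑ y, ∑ u, ∑ v, ((dMatrix F ⊗ₖ dMatrix F) * R) (x, y) (u, v) *
        T (Fin.snoc (α := fun _ => ι) (Fin.snoc (α := fun _ => ι) a u) v)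
          (Fin.snoc (α := fun _ => ι) (Fin.snoc (α := fun _ => ι) b x) y) := by
  simp only [ptr, Matrix.of_apply, Matrix.mul_apply, sum_snoc, site_last_snoc, ite_mul, zero_mul,
    Finset.sum_ite_irrel, Finset.sum_const_zero, Finset.sum_ite_eq, Finset.mem_univ, if_true,
    Fintype.sum_prod_type, Matrix.kroneckerMap_apply, smul_eq_mul]
  simp only [Finset.sum_mul, Finset.mul_sum]
  refine Finset.sum_congr rfl fun x _ => ?_
  rw [Finset.sum_comm]
  refine Finset.sum_congr rfl fun x' _ => ?_
  rw [sum_comm_pair]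
  simp only [mul_assoc]

theorem ptr_ptr_mul_site {m : ℕ} (T : Matrix (Fin (m + 2) → ι) (Fin (m + 2) → ι) K)
    (a b : Fin m → ι) :
    ptr F (ptr F (T * site R (m + 2) m)) a b =
      ∑ x, ∑ y, ∑ u, ∑ v, (R * (dMatrix F ⊗ₖ dMatrix F)) (x, y) (u, v) *
        T (Fin.snoc (α := fun _ => ι) (Fin.snoc (α := fun _ => ι) a u) v)
          (Fin.snoc (α := fun _ => ι) (Fin.snoc (α := fun _ => ι) b x) y) := by
  simp only [ptr, Matrix.of_apply, Matrix.mul_apply, sum_snoc, site_last_snoc, mul_ite, mul_zero,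
    Finset.sum_ite_irrel, Finset.sum_const_zero, Finset.sum_ite_eq', Finset.mem_univ, if_true,
    Fintype.sum_prod_type, Matrix.kroneckerMap_apply, smul_eq_mul]
  simp only [Finset.sum_mul, Finset.mul_sum]
  rw [Finset.sum_congr rfl fun x _ => Finset.sum_comm,
    Finset.sum_congr rfl fun x _ => Finset.sum_congr rfl fun x' _ => sum_comm_pair _, sum_comm_pair]
  refine Finset.sum_congr rfl fun u _ => Finset.sum_congr rfl fun v _ => ?_
  rw [sum_comm_pair]
  refine Finset.sum_congr rfl fun y _ => Finset.sum_congr rfl fun y' _ =>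
    Finset.sum_congr rfl fun x _ => Finset.sum_congr rfl fun x' _ => ?_
  ring

theorem site_four_zero_mul (X : Matrix (ι × ι) (ι × ι) K)
    (Y : Matrix (Fin 4 → ι) (Fin 4 → ι) K) (w x y z : ι) (b : Fin 4 → ι) :
    (site X 4 0 * Y) ![w, x, y, z] b = ∑ u, ∑ v, X (w, x) (u, v) * Y ![u, v, y, z] b := by
  simp only [Matrix.mul_apply, sum_fin_four, site_four_zero, ite_mul, zero_mul,
    Finset.sum_ite_irrel, Finset.sum_const_zero, Finset.sum_ite_eq, Finset.mem_univ, if_true]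

theorem site_four_one_mul (X : Matrix (ι × ι) (ι × ι) K)
    (Y : Matrix (Fin 4 → ι) (Fin 4 → ι) K) (w x y z : ι) (b : Fin 4 → ι) :
    (site X 4 1 * Y) ![w, x, y, z] b = ∑ u, ∑ v, X (x, y) (u, v) * Y ![w, u, v, z] b := by
  simp only [Matrix.mul_apply, sum_fin_four, site_four_one, ite_mul, zero_mul,
    Finset.sum_ite_irrel, Finset.sum_const_zero, Finset.sum_ite_eq, Finset.mem_univ, if_true]

theorem site_four_two_mul (X : Matrix (ι × ι) (ι × ι) K)
    (Y : Matrix (Fin 4 → ι) (Fin 4 → ι) K) (w x y z : ι) (b : Fin 4 → ι) :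
    (site X 4 2 * Y) ![w, x, y, z] b = ∑ u, ∑ v, X (y, z) (u, v) * Y ![w, x, u, v] b := by
  simp only [Matrix.mul_apply, sum_fin_four, site_four_two, ite_mul, zero_mul,
    Finset.sum_ite_irrel, Finset.sum_const_zero, Finset.sum_ite_eq, Finset.mem_univ, if_true]

/-- The crossing of the factors `1`, `2` with the factors `3`, `4`. -/
def doubleCrossing (F : Matrix (ι × ι) (ι × ι) K) : Matrix (Fin 4 → ι) (Fin 4 → ι) K :=
  site F 4 1 * (site F 4 2 * (site F 4 0 * site F 4 1))

theorem doubleCrossing_apply (w x y z w' x' y' z' : ι) :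
    doubleCrossing F ![w, x, y, z] ![w', x', y', z'] =
      ∑ c, ∑ d, F (x, y) (c, d) * ∑ e, F (d, z) (e, z') *
        ∑ g, F (w, c) (w', g) * F (g, e) (x', y') := by
  simp [doubleCrossing, site_four_one_mul, site_four_two_mul, site_four_zero_mul, site_four_one]

/-- An operator on the factors `3`, `4` is determined by the partial trace over these factors of
its product with the crossing: the four factors `F` of the crossing are cancelled one by one. -/
theorem IsSkewInverse.eq_of_doubleCrossing {Ψ : Matrix (ι × ι) (ι × ι) K}
    (h : IsSkewInverse F Ψ) {Z Z' : Matrix (ι × ι) (ι × ι) K}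
    (hZ : ∀ a b : Fin 2 → ι,
      ∑ x, ∑ y, ∑ u, ∑ v, Z (x, y) (u, v) * doubleCrossing F
        (Fin.snoc (α := fun _ => ι) (Fin.snoc (α := fun _ => ι) a u) v)
        (Fin.snoc (α := fun _ => ι) (Fin.snoc (α := fun _ => ι) b x) y) =
      ∑ x, ∑ y, ∑ u, ∑ v, Z' (x, y) (u, v) * doubleCrossing F
        (Fin.snoc (α := fun _ => ι) (Fin.snoc (α := fun _ => ι) a u) v)
        (Fin.snoc (α := fun _ => ι) (Fin.snoc (α := fun _ => ι) b x) y)) : Z = Z' := by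
  have hsnoc (a b u v : ι) : Fin.snoc (α := fun _ => ι)
      (Fin.snoc (α := fun _ => ι) ![a, b] u) v = ![a, b, u, v] := by
    funext i
    fin_cases i <;> rfl
  have key (Z : Matrix (ι × ι) (ι × ι) K) (a a' b b' : ι) :
      ∑ x, ∑ y, ∑ u, ∑ v, Z (x, y) (u, v) * doubleCrossing F ![a, a', u, v] ![b, b', x, y] =
      ∑ c, ∑ g, F (a, c) (b, g) * ∑ u, ∑ d, F (a', u) (c, d) * ∑ e, ∑ x, F (g, e) (b', x) *
        ∑ v, ∑ y, F (d, v) (e, y) * Z (x, y) (u, v) := by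
    simp only [doubleCrossing_apply, Finset.mul_sum]
    rw [sum_comm_crossing fun x y u v c d e g => Z (x, y) (u, v) *
      (F (a', u) (c, d) * (F (d, v) (e, y) * (F (a, c) (b, g) * F (g, e) (b', x))))]
    refine Finset.sum_congr rfl fun c _ => Finset.sum_congr rfl fun g _ =>
      Finset.sum_congr rfl fun u _ => Finset.sum_congr rfl fun d _ =>
      Finset.sum_congr rfl fun e _ => Finset.sum_congr rfl fun x _ =>
      Finset.sum_congr rfl fun v _ => Finset.sum_congr rfl fun y _ => ?_
    ring
  ext ⟨x, y⟩ ⟨u, v⟩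
  refine h.cancel (v := fun v y => Z (x, y) (u, v)) (w := fun v y => Z' (x, y) (u, v))
    (fun d e => ?_) v y
  refine h.cancel (v := fun e x => ∑ v, ∑ y, F (d, v) (e, y) * Z (x, y) (u, v))
    (w := fun e x => ∑ v, ∑ y, F (d, v) (e, y) * Z' (x, y) (u, v)) (fun g b' => ?_) e x
  refine h.cancel (v := fun u d => ∑ e, ∑ x, F (g, e) (b', x) *
      ∑ v, ∑ y, F (d, v) (e, y) * Z (x, y) (u, v))
    (w := fun u d => ∑ e, ∑ x, F (g, e) (b', x) *
      ∑ v, ∑ y, F (d, v) (e, y) * Z' (x, y) (u, v)) (fun a' c => ?_) u d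
  refine h.cancel (v := fun c g => ∑ u, ∑ d, F (a', u) (c, d) * ∑ e, ∑ x, F (g, e) (b', x) *
      ∑ v, ∑ y, F (d, v) (e, y) * Z (x, y) (u, v))
    (w := fun c g => ∑ u, ∑ d, F (a', u) (c, d) * ∑ e, ∑ x, F (g, e) (b', x) *
      ∑ v, ∑ y, F (d, v) (e, y) * Z' (x, y) (u, v)) (fun a b => ?_) c g
  have := hZ ![a, a'] ![b, b']
  simp only [hsnoc] at this
  rwa [key, key] at this

/-- Compatibility of `R` and `F` in any adjacent factors. -/
theorem Compatible.site_semiconj (h : Compatible R F) {m i : ℕ} (hi : i + 2 < m) :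
    SemiconjBy (site F m i * site F m (i + 1)) (site R m i) (site R m (i + 1)) := by
  rw [SemiconjBy, ← mul_assoc]
  exact site_rel h.right hi

theorem Compatible.site_semiconj' (h : Compatible R F) {m i : ℕ} (hi : i + 2 < m) :
    SemiconjBy (site F m (i + 1) * site F m i) (site R m (i + 1)) (site R m i) := by
  rw [SemiconjBy, ← mul_assoc]
  exact (site_rel h.left hi).symm

theorem IsRMatrix.compatible (h : IsRMatrix F) : Compatible F F :=
  ⟨h.yangBaxter, h.yangBaxter⟩

/-- The crossing moves operators in the factors `1`, `2` to the factors `3`, `4`. -/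
theorem Compatible.doubleCrossing_semiconj (h : Compatible R F) :
    SemiconjBy (doubleCrossing F) (site R 4 0) (site R 4 2) := by
  have h1 := (h.site_semiconj (m := 4) (i := 1) (by omega)).mul_left
    (h.site_semiconj (m := 4) (i := 0) (by omega))
  simpa [doubleCrossing, mul_assoc] using h1

/-- The crossing moves operators in the factors `3`, `4` to the factors `1`, `2`. -/
theorem Compatible.doubleCrossing_semiconj' (h : Compatible R F) :
    SemiconjBy (doubleCrossing F) (site R 4 2) (site R 4 0) := by
  have h1 := (h.site_semiconj' (m := 4) (i := 0) (by omega)).mul_left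
    (h.site_semiconj' (m := 4) (i := 1) (by omega))
  have h2 := (site_commute F F 4 (i := 0) (j := 2) le_rfl).eq
  rw [doubleCrossing, ← mul_assoc (site F 4 2), ← h2]
  simpa [mul_assoc] using h1

theorem site_twist_twist (R F : Matrix (ι × ι) (ι × ι) K) (m i : ℕ) :
    site (twist (twist R F) F) m i =
      site F m i * site F m i * site R m i * site F⁻¹ m i * site F⁻¹ m i := by
  simp only [twist, site_mul, mul_assoc]

/-- The quantum trace over the last two factors of the crossing is `F²`: one of the four factors
`F` is removed by the trace over the last factor, another one, after the Yang–Baxter equation, by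
the trace over the third. -/
theorem ptr_ptr_doubleCrossing_mul (hF : IsClosedRMatrix F)
    (U : Matrix (Fin 2 → ι) (Fin 2 → ι) K) :
    ptr F (ptr F (doubleCrossing F * addLeg K (addLeg K U))) = site F 2 0 * site F 2 0 * U := by
  have e4 : doubleCrossing F * addLeg K (addLeg K U) =
      addLeg K (site F 3 1) * (site F 4 2 * addLeg K (site F 3 0 * site F 3 1 * addLeg K U)) := by
    rw [doubleCrossing, site_eq_addLeg F (m := 3) (i := 1) (by omega),
      site_eq_addLeg F (m := 3) (i := 0) (by omega)]
    simp only [map_mul, mul_assoc]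
  have e3 : site F 3 1 * (site F 3 0 * site F 3 1 * addLeg K U) =
      addLeg K (site F 2 0) * (site F 3 1 * addLeg K (site F 2 0 * U)) := by
    have := hF.isRMatrix.yangBaxter
    rw [← mul_assoc, ← mul_assoc, ← this, site_eq_addLeg F (m := 2) (i := 0) (by omega)]
    simp only [map_mul, mul_assoc]
  rw [e4, ptr_addLeg_mul, ptr_mul_addLeg, ptr_site_last hF 2, one_mul, e3, ptr_addLeg_mul,
    ptr_mul_addLeg, ptr_site_last hF 1, one_mul, mul_assoc]

/-- `D₁ D₂ R = F² R F⁻² D₁ D₂`. Both sides have the same quantum trace over the last two factors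
with the crossing, in which `R₁` and `R₃` are exchanged. -/
theorem kronecker_dMatrix_mul (hF : IsClosedRMatrix F) (hRF : Compatible R F) :
    (dMatrix F ⊗ₖ dMatrix F) * R = twist (twist R F) F * (dMatrix F ⊗ₖ dMatrix F) := by
  obtain ⟨Ψ, hΨ⟩ := hF.skewInvertible
  refine hΨ.eq_of_doubleCrossing fun a b => ?_
  rw [← ptr_ptr_site_mul, ← ptr_ptr_mul_site]
  refine congrFun (congrFun ?_ a) b
  have h4 (X : Matrix (ι × ι) (ι × ι) K) : site X 4 0 = addLeg K (addLeg K (site X 2 0)) := by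
    rw [site_eq_addLeg X (m := 3) (by omega), site_eq_addLeg X (m := 2) (by omega)]
  have hFF := hF.isRMatrix.compatible.doubleCrossing_semiconj'
  have hFF' : SemiconjBy (doubleCrossing F) (site F⁻¹ 4 2) (site F⁻¹ 4 0) := by
    have h1 := hFF.eq
    calc doubleCrossing F * site F⁻¹ 4 2
        = site F⁻¹ 4 0 * (site F 4 0 * doubleCrossing F) * site F⁻¹ 4 2 := by
          rw [← mul_assoc (site F⁻¹ 4 0), hF.isRMatrix.site_inv_mul, one_mul]
      _ = site F⁻¹ 4 0 * doubleCrossing F := by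
          rw [← h1, mul_assoc, mul_assoc, hF.isRMatrix.site_mul_inv, mul_one]
  have hR : SemiconjBy (doubleCrossing F) (site (twist (twist R F) F) 4 2)
      (site (twist (twist R F) F) 4 0) := by
    rw [site_twist_twist, site_twist_twist]
    exact (((hFF.mul_right hFF).mul_right hRF.doubleCrossing_semiconj').mul_right
      hFF').mul_right hFF'
  have e1 : ptr F (ptr F (site R 4 2 * doubleCrossing F)) =
      site F 2 0 * site F 2 0 * site R 2 0 := by
    rw [← hRF.doubleCrossing_semiconj.eq, h4, ptr_ptr_doubleCrossing_mul hF]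
  have e2 : ptr F (ptr F (doubleCrossing F * site (twist (twist R F) F) 4 2)) =
      site F 2 0 * site F 2 0 * site R 2 0 := by
    have e3 := ptr_ptr_doubleCrossing_mul hF 1
    rw [map_one, map_one, mul_one, mul_one] at e3
    rw [hR.eq, h4, ptr_addLeg_mul, ptr_addLeg_mul, e3, site_twist_twist]
    simp only [mul_assoc]
    rw [← mul_assoc (site F⁻¹ 2 0) (site F 2 0), hF.isRMatrix.site_inv_mul, one_mul,
      hF.isRMatrix.site_inv_mul, mul_one]
  exact e1.trans e2.symm

/-- An exchange relation of an operator with `D ⊗ D` holds in any two adjacent factors. -/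
theorem dPow_mul_site {R' : Matrix (ι × ι) (ι × ι) K}
    (h : (dMatrix F ⊗ₖ dMatrix F) * R = R' * (dMatrix F ⊗ₖ dMatrix F)) (m i : ℕ) :
    dPow F m * site R m i = site R' m i * dPow F m := by
  induction i generalizing m with
  | zero =>
    by_cases hm : m < 2
    · rw [site_of_le R (by omega), site_of_le R' (by omega), one_mul, mul_one]
    · obtain ⟨m, rfl⟩ := Nat.exists_eq_add_of_le' (not_lt.1 hm)
      ext a b
      obtain ⟨x, a, rfl⟩ := cons_surj a
      obtain ⟨x', b, rfl⟩ := cons_surj b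
      obtain ⟨y, a, rfl⟩ := cons_surj a
      obtain ⟨y', b, rfl⟩ := cons_surj b
      have h1 := congrFun (congrFun h (x, y)) (x', y')
      simp only [Matrix.mul_apply, Fintype.sum_prod_type, Matrix.kroneckerMap_apply] at h1
      have h2 := congrArg (· * dPow F m a b) h1
      simp only [Finset.sum_mul] at h2
      simp only [Matrix.mul_apply, sum_cons, site_zero_cons, dPow_cons, mul_ite, ite_mul, mul_zero,
        zero_mul, Finset.sum_ite_eq, Finset.sum_ite_eq', Finset.mem_univ, if_true]
      refine Eq.trans ?_ (h2.trans ?_) <;>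
        exact Finset.sum_congr rfl fun u _ => Finset.sum_congr rfl fun v _ => by ring
  | succ i ih =>
    rcases m with _ | m
    · rw [site_of_le R (by omega), site_of_le R' (by omega), one_mul, mul_one]
    · rw [site_eq_consLeg, site_eq_consLeg]
      ext a b
      obtain ⟨x, a, rfl⟩ := cons_surj a
      obtain ⟨x', b, rfl⟩ := cons_surj b
      have h1 := congrArg (dMatrix F x x' * ·) (congrFun (congrFun (ih m) a) b)
      simp only [Matrix.mul_apply, Finset.mul_sum] at h1
      simp only [Matrix.mul_apply, sum_cons, consLeg_cons, dPow_cons, mul_ite, ite_mul, mul_zero,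
        zero_mul, Finset.sum_ite_irrel, Finset.sum_const_zero, Finset.sum_ite_eq,
        Finset.sum_ite_eq', Finset.mem_univ, if_true]
      convert h1 using 2 <;> ring

theorem trace_scalarMap_mul_comm {κ : Type*} [Fintype κ] (X : Matrix κ κ K) (Z : Matrix κ κ B) :
    (scalarMap B X * Z).trace = (Z * scalarMap B X).trace := by
  simp only [Matrix.trace, Matrix.diag, Matrix.mul_apply, scalarMap, Matrix.map_apply]
  rw [Finset.sum_comm]
  simp only [Algebra.commutes]

/-- The quantum trace is cyclic up to the replacement of `R` by its double twist. -/
theorem qTrace_site_mul (hF : IsClosedRMatrix F) (hRF : Compatible R F) (m i : ℕ)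
    (Z : Matrix (Fin m → ι) (Fin m → ι) B) :
    qTrace F m (scalarMap B (site R m i) * Z) =
      qTrace F m (Z * scalarMap B (site (twist (twist R F) F) m i)) := by
  have h1 := dPow_mul_site (kronecker_dMatrix_mul hF hRF) m i
  change (scalarMap B (dPow F m) * _).trace = (scalarMap B (dPow F m) * _).trace
  rw [← mul_assoc, ← scalarMap_mul, h1, scalarMap_mul, mul_assoc, trace_scalarMap_mul_comm,
    mul_assoc]

end PartialTraceConj

/-! ### Factorization of quantum traces -/

section Factorization

variable {K ι B : Type*} [Field K] [Fintype ι] [DecidableEq ι] [Ring B] [Algebra K B]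
  {R F : Matrix (ι × ι) (ι × ι) K}

theorem scalarMap_semiconj {κ : Type*} [Fintype κ] {X Y Z : Matrix κ κ K}
    (h : SemiconjBy X Y Z) :
    SemiconjBy (scalarMap B X) (scalarMap B Y) (scalarMap B Z) := by
  rw [SemiconjBy, ← scalarMap_mul, h.eq, scalarMap_mul]

/-- `IsPTr F Y Z` says that `Y` is obtained from `Z` by taking the quantum trace over some of the
last factors. As a relation it leaves the numbers of factors of `Y` and `Z` independent, so that
they need not be of the form `j` and `j + i`. -/
inductive IsPTr (F : Matrix (ι × ι) (ι × ι) K) {j : ℕ} (Y : Matrix (Fin j → ι) (Fin j → ι) B) :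
    ∀ {m : ℕ}, Matrix (Fin m → ι) (Fin m → ι) B → Prop
  | refl : IsPTr F Y Y
  | step {m : ℕ} (Z : Matrix (Fin (m + 1) → ι) (Fin (m + 1) → ι) B) :
      IsPTr F Y (ptr F Z) → IsPTr F Y Z

namespace IsPTr

variable {j m : ℕ} {Y : Matrix (Fin j → ι) (Fin j → ι) B} {Z : Matrix (Fin m → ι) (Fin m → ι) B}

theorem le (h : IsPTr F Y Z) : j ≤ m := by
  induction h with
  | refl => exact le_rfl
  | step Z _ ih => omega

theorem qTrace_eq (h : IsPTr F Y Z) : qTrace F m Z = qTrace F j Y := by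
  induction h with
  | refl => rfl
  | step Z _ ih => rw [← ih, qTrace_ptr]

/-- A left factor `U` which acts in the first `j` factors only passes out of the trace. It is given
as a family, with one member for each number of factors. -/
theorem mul_left (h : IsPTr F Y Z) (U : ∀ m : ℕ, Matrix (Fin m → ι) (Fin m → ι) B)
    (hU : ∀ m, j ≤ m → U (m + 1) = addLeg K (U m)) : IsPTr F (U j * Y) (U m * Z) := by
  induction h with
  | refl => exact refl
  | step Z h ih =>
    refine step _ ?_
    rwa [hU _ h.le, ptr_addLeg_mul]

end IsPTr

/-- The quantum trace over all factors is an operator on the tensor power with no factors. -/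
theorem isPTr_qTrace {m : ℕ} (Z : Matrix (Fin m → ι) (Fin m → ι) B) :
    IsPTr F (Matrix.diagonal fun _ : Fin 0 → ι => qTrace F m Z) Z := by
  induction m with
  | zero =>
    have : Matrix.diagonal (fun _ : Fin 0 → ι => qTrace F 0 Z) = Z := by
      ext a b
      simp [qTrace_eq_sum, dPow, Subsingleton.elim a default, Subsingleton.elim b default]
    rw [this]
    exact IsPTr.refl
  | succ m ih =>
    rw [← qTrace_ptr]
    exact IsPTr.step _ (ih _)

theorem addLeg_seqProd_site (X : Matrix (ι × ι) (ι × ι) K) {m n : ℕ} (h : n < m) :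
    addLeg K (seqProd (site X m) n) = seqProd (site X (m + 1)) n := by
  induction n with
  | zero => exact map_one _
  | succ n ih => rw [seqProd, seqProd, map_mul, ih (by omega), site_eq_addLeg X (by omega)]

theorem addLeg_seqProdInv_site (X : Matrix (ι × ι) (ι × ι) K) {m n : ℕ} (h : n < m) :
    addLeg K (seqProdInv (site X m) n) = seqProdInv (site X (m + 1)) n := by
  induction n with
  | zero => exact map_one _
  | succ n ih => rw [seqProdInv, seqProdInv, map_mul, ih (by omega), site_eq_addLeg X (by omega)]

/-- Partial quantum traces are compatible with the conjugation that moves all the factors by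
one. -/
theorem IsPTr.conj (hF : IsClosedRMatrix F) {j m : ℕ} {Y : Matrix (Fin j → ι) (Fin j → ι) B}
    {Z : Matrix (Fin m → ι) (Fin m → ι) B} (h : IsPTr F Y Z) :
    IsPTr F
      (scalarMap B (seqProd (site F (j + 1)) j) * addLeg K Y *
        scalarMap B (seqProdInv (site F⁻¹ (j + 1)) j))
      (scalarMap B (seqProd (site F (m + 1)) m) * addLeg K Z *
        scalarMap B (seqProdInv (site F⁻¹ (m + 1)) m)) := by
  induction h with
  | refl => exact refl
  | @step m Z h ih =>
    refine step _ ?_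
    rw [seqProd, seqProdInv, ← addLeg_seqProd_site F (m := m + 1) (n := m) (by omega),
      ← addLeg_seqProdInv_site F⁻¹ (m := m + 1) (n := m) (by omega), scalarMap_mul, scalarMap_mul, scalarMap_addLeg,
      scalarMap_addLeg, mul_assoc _ _ (addLeg K Z), ← mul_assoc, mul_assoc (addLeg K _),
      mul_assoc (addLeg K _), ptr_addLeg_mul, ptr_mul_addLeg, ptr_conj hF, ← mul_assoc]
    exact ih

variable (M : Matrix ι ι B)

theorem copy_eq_seqCopy (F : Matrix (ι × ι) (ι × ι) K) (m j : ℕ) :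
    copy F M m j = seqCopy (fun i => scalarMap B (site F m i))
      (fun i => scalarMap B (site F⁻¹ m i)) (firstSite M m) j := by
  induction j with
  | zero => rfl
  | succ j ih => rw [copy, seqCopy, ih]

theorem copyProd_eq_copyRange (F : Matrix (ι × ι) (ι × ι) K) (m j : ℕ) :
    copyProd F M m j = copyRange (copy F M m) 0 j := by
  induction j with
  | zero => rfl
  | succ j ih => rw [copyProd, copyRange, ih, zero_add]

theorem copyProd_add (F : Matrix (ι × ι) (ι × ι) K) (m i j : ℕ) :
    copyProd F M m (i + j) = copyProd F M m j * copyRange (copy F M m) j i := by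
  induction i with
  | zero => rw [zero_add, copyRange, mul_one]
  | succ i ih => rw [add_right_comm, copyProd, ih, copyRange, ← mul_assoc, add_comm i j]

theorem addLeg_copy (F : Matrix (ι × ι) (ι × ι) K) {m j : ℕ} (h : j < m) :
    addLeg K (copy F M m j) = copy F M (m + 1) j := by
  induction j with
  | zero => exact (firstSite_eq_addLeg M h).symm
  | succ j ih =>
    rw [copy, copy, map_mul, map_mul, ih (by omega), site_eq_addLeg F h, site_eq_addLeg F⁻¹ h,
      scalarMap_addLeg, scalarMap_addLeg]

theorem addLeg_copyRange (F : Matrix (ι × ι) (ι × ι) K) {m j i : ℕ} (h : j + i ≤ m) :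
    addLeg K (copyRange (copy F M m) j i) = copyRange (copy F M (m + 1)) j i := by
  induction i with
  | zero => exact map_one _
  | succ i ih => rw [copyRange, copyRange, map_mul, ih (by omega), addLeg_copy M F (by omega)]

/-- The operators in `V^{⊗ m}` satisfy the relations of a braided sequence. -/
theorem braidedSeq_site (hF : IsRMatrix F) (hRF : Compatible R F) (m : ℕ) :
    BraidedSeq (fun i => scalarMap B (site F m i)) (fun i => scalarMap B (site F⁻¹ m i))
      (fun i => scalarMap B (site R m i)) (firstSite M m) (m - 1) where
  mul_inv i := by rw [← scalarMap_mul, hF.site_mul_inv, scalarMap_one]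
  inv_mul i := by rw [← scalarMap_mul, hF.site_inv_mul, scalarMap_one]
  braid i hi := by
    rw [← scalarMap_mul]
    exact scalarMap_semiconj (hF.compatible.site_semiconj (by omega))
  braid' i hi := by
    rw [← scalarMap_mul]
    exact scalarMap_semiconj (hF.compatible.site_semiconj' (by omega))
  compat i hi := by
    rw [← scalarMap_mul]
    exact scalarMap_semiconj (hRF.site_semiconj (by omega))
  compat' i hi := by
    rw [← scalarMap_mul]
    exact scalarMap_semiconj (hRF.site_semiconj' (by omega))
  comm_ff i j hij := scalarMap_semiconj (site_commute F F m hij)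
  comm_fr i j hij := scalarMap_semiconj (site_commute F R m hij)
  comm_rf i j hij := scalarMap_semiconj (site_commute R F m hij)
  comm_fx i := firstSite_commute M F m i
  comm_rx i := firstSite_commute M R m i

theorem scalarMap_seqProd {κ : Type*} [Fintype κ] [DecidableEq κ] (r : ℕ → Matrix κ κ K)
    (n : ℕ) : scalarMap B (seqProd r n) = seqProd (fun i => scalarMap B (r i)) n := by
  induction n with
  | zero => exact scalarMap_one
  | succ n ih => rw [seqProd, seqProd, scalarMap_mul, ih]

theorem scalarMap_seqProdInv {κ : Type*} [Fintype κ] [DecidableEq κ] (r : ℕ → Matrix κ κ K)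
    (n : ℕ) : scalarMap B (seqProdInv r n) = seqProdInv (fun i => scalarMap B (r i)) n := by
  induction n with
  | zero => exact scalarMap_one
  | succ n ih => rw [seqProdInv, seqProdInv, scalarMap_mul, ih]

theorem scalarMap_qAntisym {κ : Type*} [Fintype κ] [DecidableEq κ] (q : K)
    (r : ℕ → Matrix κ κ K) (n : ℕ) :
    scalarMap B (qAntisym q r n) = qAntisym q (fun i => scalarMap B (r i)) n :=
  map_qAntisym (Algebra.ofId K B).mapMatrix q r n

theorem scalarMap_mul_diagonal {κ : Type*} [Fintype κ] [DecidableEq κ] (X : Matrix κ κ K)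
    (c : B) : scalarMap B X * Matrix.diagonal (fun _ => c) =
      Matrix.diagonal (fun _ => c) * scalarMap B X := by
  ext a b
  simp [scalarMap, Algebra.commutes]

theorem addLeg_diagonal {m : ℕ} (c : B) :
    addLeg K (Matrix.diagonal fun _ : Fin m → ι => c) = Matrix.diagonal fun _ => c := by
  ext a b
  obtain ⟨a, x, rfl⟩ := snoc_surj a
  obtain ⟨b, y, rfl⟩ := snoc_surj b
  rw [addLeg_snoc, Matrix.diagonal_apply, Matrix.diagonal_apply]
  simp only [Fin.snoc_inj]
  split_ifs <;> simp_all

theorem copyRange_semiconj {E : Type*} [Ring E] {c : ℕ → E} {w : E} {j i : ℕ}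
    (h : ∀ l < j + i, SemiconjBy w (c l) (c (l + 1))) :
    SemiconjBy w (copyRange c j i) (copyRange c (j + 1) i) := by
  induction i with
  | zero => exact SemiconjBy.one_right w
  | succ i ih =>
    have h1 := h (j + i) (by omega)
    rw [add_right_comm] at h1
    exact (ih fun l hl => h l (by omega)).mul_right h1

/-- The quantum trace of the `q`-antisymmetrizer times the product of the copies of `M`. -/
noncomputable def traceAntisym (q : K) (R F : Matrix (ι × ι) (ι × ι) K) (M : Matrix ι ι B)
    (k : ℕ) : B :=
  qTrace F k (scalarMap B (qAntisym q (site R k) k) * copyProd F M k k)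

/-- The quantum trace over the last `i` factors of the `q`-antisymmetrizer in these factors, times
the product of the last `i` copies of `M`, is a multiple of the identity. -/
theorem isPTr_traceAntisym (q : K) (hF : IsClosedRMatrix F) (hRF : Compatible R F) (i j : ℕ) :
    IsPTr F (Matrix.diagonal fun _ : Fin j → ι => traceAntisym q R F M i)
      (scalarMap B (qAntisym q (fun t => site R (i + j) (t + j)) i) *
        copyRange (copy F M (i + j)) j i) := by
  induction j with
  | zero =>
    rw [traceAntisym, copyProd_eq_copyRange]
    exact isPTr_qTrace _
  | succ j ih =>
    have hb := braidedSeq_site M hF.isRMatrix hRF (i + j + 1)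
    have hb0 := braidedSeq_site M hF.isRMatrix hRF (j + 1)
    have h1 := ih.conj hF
    rw [addLeg_diagonal, scalarMap_mul_diagonal, mul_assoc, scalarMap_seqProd,
      scalarMap_seqProdInv, hb0.seqProd_mul_inv, mul_one, map_mul, addLeg_copyRange M F (by omega),
      ← scalarMap_addLeg, map_qAntisym, scalarMap_qAntisym, scalarMap_seqProd,
      scalarMap_seqProdInv] at h1
    have h2 : SemiconjBy (seqProd (fun t => scalarMap B (site F (i + j + 1) t)) (i + j))
        (qAntisym q (fun t => scalarMap B (addLeg K (site R (i + j) (t + j)))) i)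
        (qAntisym q (fun t => scalarMap B (site R (i + j + 1) (t + (j + 1)))) i) := by
      refine qAntisym_semiconj q i fun t ht => ?_
      rw [← site_eq_addLeg R (by omega)]
      exact hb.seqProd_semiconj_r (i := t + j) (by omega) (by omega)
    have h3 : SemiconjBy (seqProd (fun t => scalarMap B (site F (i + j + 1) t)) (i + j))
        (copyRange (copy F M (i + j + 1)) j i) (copyRange (copy F M (i + j + 1)) (j + 1) i) := by
      refine copyRange_semiconj fun l hl => ?_
      rw [copy_eq_seqCopy, copy_eq_seqCopy]
      exact hb.seqProd_semiconj_copy (by omega) (by omega)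
    rw [(h2.mul_right h3).eq, mul_assoc, hb.seqProd_mul_inv, mul_one] at h1
    rw [scalarMap_qAntisym]
    exact h1

theorem qTrace_mul_diagonal {m : ℕ} (Z : Matrix (Fin m → ι) (Fin m → ι) B) (c : B) :
    qTrace F m (Z * Matrix.diagonal fun _ => c) = qTrace F m Z * c := by
  simp [qTrace_eq_sum, Matrix.mul_diagonal, Finset.sum_mul]

theorem chain_eq_seqProd (R : Matrix (ι × ι) (ι × ι) K) (m j : ℕ) :
    chain R m j = seqProd (site R m) j := by
  induction j with
  | zero => rfl
  | succ j ih => rw [chain, seqProd, ih]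

/-- A product of a power sum and a trace of an antisymmetrizer is a single quantum trace. -/
theorem powerSum_mul_traceAntisym (q : K) (hF : IsClosedRMatrix F) (hRF : Compatible R F)
    (i j : ℕ) :
    powerSum R F M (j + 1) * traceAntisym q R F M i =
      qTrace F (i + (j + 1)) (scalarMap B (seqProd (site R (i + (j + 1))) j *
        qAntisym q (fun t => site R (i + (j + 1)) (t + (j + 1))) i) *
        copyProd F M (i + (j + 1)) (i + (j + 1))) := by
  have h1 := (isPTr_traceAntisym M q hF hRF i (j + 1)).mul_left
    (fun m => scalarMap B (seqProd (site R m) j) * copyProd F M m (j + 1)) fun m hm => by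
      rw [map_mul, copyProd_eq_copyRange, copyProd_eq_copyRange, addLeg_copyRange M F (by omega),
        ← scalarMap_addLeg, addLeg_seqProd_site R (by omega)]
  have h2 := h1.qTrace_eq
  rw [qTrace_mul_diagonal] at h2
  rw [powerSum, chain_eq_seqProd, ← h2, copyProd_add M F _ i (j + 1), scalarMap_mul]
  have hb := braidedSeq_site M hF.isRMatrix hRF (i + (j + 1))
  have h3 : Commute
      (scalarMap B (qAntisym q (fun t => site R (i + (j + 1)) (t + (j + 1))) i))
      (copyProd F M (i + (j + 1)) (j + 1)) := by
    have (l : ℕ) (hl : l ≤ j + 1) : Commute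
        (scalarMap B (qAntisym q (fun t => site R (i + (j + 1)) (t + (j + 1))) i))
        (copyProd F M (i + (j + 1)) l) := by
      induction l with
      | zero => exact Commute.one_right _
      | succ l ih =>
        rw [copyProd]
        refine (ih (by omega)).mul_right ?_
        rw [scalarMap_qAntisym, copy_eq_seqCopy]
        exact (qAntisym_semiconj q i fun t ht =>
          (hb.r_commute_copy_of_lt (i := t + (j + 1)) (by omega)).symm).symm
    exact this _ le_rfl
  congr 1
  simp only [mul_assoc]
  rw [← mul_assoc (scalarMap B (qAntisym q _ i)), h3.eq]
  simp only [mul_assoc]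

theorem traceAntisym_zero (q : K) : traceAntisym q R F M 0 = 1 := by
  simp [traceAntisym, qTrace_eq_sum, dPow, qAntisym_zero, scalarMap_one, copyProd]

/-- The defining relation of the quantum matrix algebra, for a matrix over any algebra. -/
def IsQuantumMatrix (R F : Matrix (ι × ι) (ι × ι) K) (M : Matrix ι ι B) : Prop :=
  scalarMap B (site R 2 0) * copy F M 2 0 * copy F M 2 1 =
    copy F M 2 0 * copy F M 2 1 * scalarMap B (site (twist (twist R F) F) 2 0)

variable {M}

theorem IsQuantumMatrix.rel (h : IsQuantumMatrix R F M) {m : ℕ} (hm : 2 ≤ m) :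
    scalarMap B (site R m 0) * copy F M m 0 * copy F M m 1 =
      copy F M m 0 * copy F M m 1 * scalarMap B (site (twist (twist R F) F) m 0) := by
  induction m, hm using Nat.le_induction with
  | base => exact h
  | succ m hm ih =>
    have := congrArg (addLeg K) ih
    simpa only [map_mul, ← scalarMap_addLeg, addLeg_copy M F (show 0 < m by omega),
      addLeg_copy M F (show 1 < m by omega), ← site_eq_addLeg _ (show 0 + 1 < m by omega)] using this

/-- The linear functional `X ↦ Tr_F (X M₁ ⋯ M_m)`. -/
noncomputable def traceFunctional (F : Matrix (ι × ι) (ι × ι) K) (M : Matrix ι ι B) (m : ℕ) :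
    Matrix (Fin m → ι) (Fin m → ι) K →ₗ[K] B where
  toFun X := qTrace F m (scalarMap B X * copyProd F M m m)
  map_add' X Y := by
    simp [qTrace, scalarMap, Matrix.map_add, add_mul, mul_add]
  map_smul' c X := by
    have : scalarMap B (c • X) = c • scalarMap B X :=
      map_smul (Algebra.ofId K B).mapMatrix c X
    simp [qTrace, this]

/-- The functional is a trace with respect to the generators of the Hecke algebra. -/
theorem traceFunctional_site_mul (hF : IsClosedRMatrix F) (hRF : Compatible R F)
    (hM : IsQuantumMatrix R F M) {m i : ℕ} (hi : i + 1 < m)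
    (X : Matrix (Fin m → ι) (Fin m → ι) K) :
    traceFunctional F M m (site R m i * X) = traceFunctional F M m (X * site R m i) := by
  have hb := braidedSeq_site M hF.isRMatrix hRF m
  have h1 : scalarMap B (site R m i) * copyProd F M m m =
      copyProd F M m m * scalarMap B (site (twist (twist R F) F) m i) := by
    have h0 := hM.rel (m := m) (by omega)
    rw [copy_eq_seqCopy, copy_eq_seqCopy] at h0
    have := hb.r_mul_copyRange (i := i) (k := m)
      (r'' := fun i => scalarMap B (site (twist (twist R F) F) m i))
      (fun i => by simp only [site_twist_twist, scalarMap_mul]) h0 (by omega) (by omega)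
    rw [copyProd_eq_copyRange, funext (copy_eq_seqCopy M F m)]
    exact this
  change qTrace F m (scalarMap B _ * _) = qTrace F m (scalarMap B _ * _)
  rw [scalarMap_mul, scalarMap_mul, mul_assoc, qTrace_site_mul hF hRF, mul_assoc, mul_assoc, h1]

theorem heckeSeq_site {q : K} (hR : IsRMatrix R) (hRq : R * R = 1 + (q - q⁻¹) • R) (m : ℕ) :
    HeckeSeq q (site R m) (m - 1) where
  hecke i hi := site_hecke hRq (by omega)
  braid i hi := site_rel hR.yangBaxter (by omega)
  comm i j hij _ := site_commute R R m hij

/-- The Newton relations between power sums and traces of antisymmetrizers. -/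
theorem newton_traceAntisym {q : K} (hq : q ≠ 0) (hqInt : ∀ k : ℕ, 1 ≤ k → qInt q k ≠ 0)
    (hR : IsRMatrix R) (hRq : R * R = 1 + (q - q⁻¹) • R) (hF : IsClosedRMatrix F)
    (hRF : Compatible R F) (hM : IsQuantumMatrix R F M) (N : ℕ) :
    ((-1) ^ N * qInt q (N + 1)) • traceAntisym q R F M (N + 1) =
      ∑ i ∈ Finset.range (N + 1), (-q) ^ i •
        (powerSum R F M (N + 1 - i) * traceAntisym q R F M i) := by
  have h1 := (heckeSeq_site hR hRq (N + 1)).newton hq hqInt (traceFunctional F M (N + 1))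
    fun i hi X => traceFunctional_site_mul hF hRF hM (by omega) X
  have hT (X) : traceFunctional F M (N + 1) X =
      qTrace F (N + 1) (scalarMap B X * copyProd F M (N + 1) (N + 1)) := rfl
  have hE : traceAntisym q R F M (N + 1) =
      traceFunctional F M (N + 1) (qAntisym q (site R (N + 1)) (N + 1)) := rfl
  rw [Nat.add_sub_cancel] at h1
  rw [hE, h1]
  refine Finset.sum_congr rfl fun i hi => ?_
  obtain ⟨j, rfl⟩ := Nat.exists_eq_add_of_le (Finset.mem_range_succ_iff.1 hi)
  rw [hT, show i + j + 1 - i = j + 1 by omega, powerSum_mul_traceAntisym M q hF hRF,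
    show i + j - i = j by omega]
  rfl

theorem elemSym_eq (q : K) (k : ℕ) : elemSym q R F M k = traceAntisym q R F M k := by
  have h (m k : ℕ) : antisymmetrizer q R m k = qAntisym q (site R m) k := by
    induction k using Nat.strong_induction_on with
    | _ k ih =>
      match k with
      | 0 => rfl
      | 1 => rfl
      | k + 2 => rw [antisymmetrizer, qAntisym, ih (k + 1) (by omega)]
  rcases k with _ | k
  · rw [traceAntisym_zero, elemSym]
  · rw [elemSym, h, traceAntisym]

/-- The symmetrizers are the antisymmetrizers for the parameter `-q⁻¹`. -/
theorem complSym_eq {q : K} (hq : q ≠ 0) (k : ℕ) :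
    complSym q R F M k = traceAntisym (-q⁻¹) R F M k := by
  have h (m k : ℕ) : symmetrizer q R m k = qAntisym (-q⁻¹) (site R m) k := by
    induction k using Nat.strong_induction_on with
    | _ k ih =>
      match k with
      | 0 => rfl
      | 1 => rfl
      | k + 2 =>
        have h1 : ((-1 : K) ^ (k + 1)) * (-1) ^ (k + 1) = 1 := by
          rw [← mul_pow]; simp
        have h2 : ((-q⁻¹) ^ (k + 1) • (1 : Matrix (Fin m → ι) (Fin m → ι) K) -
            qInt (-q⁻¹) (k + 1) • site R m k) = (-1 : K) ^ (k + 1) •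
            (q⁻¹ ^ (k + 1) • (1 : Matrix (Fin m → ι) (Fin m → ι) K) +
              qInt q (k + 1) • site R m k) := by
          rw [qInt_neg_inv hq, neg_pow q⁻¹, pow_succ (-1 : K) k]
          module
        rw [symmetrizer, qAntisym, ih (k + 1) (by omega), h2, qInt_neg_inv hq (k + 1),
          mul_smul_comm, smul_mul_assoc, smul_smul, mul_inv, mul_comm, ← mul_assoc, ← inv_pow,
          inv_neg_one, h1, one_mul]
  rcases k with _ | k
  · rw [traceAntisym_zero, complSym]
  · rw [complSym, h, traceAntisym]

end Factorization

/-! ### The quantum matrix algebra -/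

section Generators

variable {K ι : Type*} [Field K] [Fintype ι] [DecidableEq ι]

theorem map_scalarMap {B B' κ : Type*} [Semiring B] [Algebra K B] [Semiring B'] [Algebra K B']
    (g : B →ₐ[K] B') (X : Matrix κ κ K) : (scalarMap B X).map g = scalarMap B' X := by
  ext a b
  simp [scalarMap]

theorem map_copy {B B' : Type*} [Semiring B] [Algebra K B] [Semiring B'] [Algebra K B']
    (g : B →ₐ[K] B') (F : Matrix (ι × ι) (ι × ι) K) (M : Matrix ι ι B) (m j : ℕ) :
    (copy F M m j).map g = copy F (M.map g) m j := by
  induction j with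
  | zero =>
    rw [copy, copy, firstSite, firstSite]
    split_ifs with h
    · ext a b
      simp [apply_ite g]
    · exact Matrix.map_one g (map_zero g) (map_one g)
  | succ j ih =>
    rw [copy, copy, Matrix.map_mul, Matrix.map_mul, ih, map_scalarMap, map_scalarMap]

/-- The ring structure which extends the given semiring structure: negation is multiplication by
`-1` in `K`. -/
noncomputable instance (R F : Matrix (ι × ι) (ι × ι) K) : Ring (QMAlgebra R F) :=
  Algebra.semiringToRing K

theorem isQuantumMatrix_genMatrix (R F : Matrix (ι × ι) (ι × ι) K) :
    IsQuantumMatrix R F (genMatrix R F) := by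
  have h1 : (freeMatrix K ι).map (RingQuot.mkAlgHom K (Rel R F)) = genMatrix R F := rfl
  ext a b
  have h2 := RingQuot.mkAlgHom_rel K (Rel.entry (R := R) (F := F) a b)
  rw [← Matrix.map_apply (f := RingQuot.mkAlgHom K (Rel R F)),
    ← Matrix.map_apply (f := RingQuot.mkAlgHom K (Rel R F))] at h2
  simp only [Matrix.map_mul, map_copy, map_scalarMap, h1] at h2
  exact h2

end Generators

end QuantumMatrix

theorem mainTheorem4 {K : Type*} [Field K] {ι : Type*} [Fintype ι] [DecidableEq ι]
    (q : K) (hq : q ≠ 0) (hqInt : ∀ k : ℕ, 1 ≤ k → QuantumMatrix.qInt q k ≠ 0)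
    (R F : Matrix (ι × ι) (ι × ι) K) (n : ℕ)
    (hR : QuantumMatrix.IsEvenHecke q R n) (hF : QuantumMatrix.IsClosedRMatrix F)
    (hRF : QuantumMatrix.Compatible R F) (k : ℕ) (hk : 1 ≤ k) :
    ((-1) ^ (k - 1) * QuantumMatrix.qInt q k) •
        QuantumMatrix.elemSym q R F (QuantumMatrix.genMatrix R F) k =
      ∑ i ∈ Finset.range k, (-q) ^ i •
        (QuantumMatrix.powerSum R F (QuantumMatrix.genMatrix R F) (k - i) *
          QuantumMatrix.elemSym q R F (QuantumMatrix.genMatrix R F) i) ∧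
    QuantumMatrix.qInt q k •
        QuantumMatrix.complSym q R F (QuantumMatrix.genMatrix R F) k =
      ∑ i ∈ Finset.range k, q⁻¹ ^ i •
        (QuantumMatrix.powerSum R F (QuantumMatrix.genMatrix R F) (k - i) *
          QuantumMatrix.complSym q R F (QuantumMatrix.genMatrix R F) i) := by
  obtain ⟨N, rfl⟩ := Nat.exists_eq_add_of_le' hk
  have hM := QuantumMatrix.isQuantumMatrix_genMatrix R F
  constructor
  · simp only [QuantumMatrix.elemSym_eq, Nat.add_sub_cancel]
    exact QuantumMatrix.newton_traceAntisym hq hqInt hR.isRMatrix hR.hecke hF hRF hM N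
  · have hq' : -q⁻¹ ≠ 0 := neg_ne_zero.2 (inv_ne_zero hq)
    have hqInt' (k : ℕ) (hk : 1 ≤ k) : QuantumMatrix.qInt (-q⁻¹) k ≠ 0 := by
      obtain ⟨k, rfl⟩ := Nat.exists_eq_add_of_le' hk
      rw [QuantumMatrix.qInt_neg_inv hq]
      exact mul_ne_zero (pow_ne_zero _ (by simp)) (hqInt _ hk)
    have hecke : R * R = 1 + (-q⁻¹ - (-q⁻¹)⁻¹) • R := by
      rw [hR.hecke, inv_neg, inv_inv, sub_neg_eq_add, neg_add_eq_sub]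
    have h := QuantumMatrix.newton_traceAntisym hq' hqInt' hR.isRMatrix hecke hF hRF hM N
    rw [QuantumMatrix.qInt_neg_inv hq, ← mul_assoc, ← mul_pow, neg_one_mul, neg_neg, one_pow,
      one_mul, neg_neg] at h
    simp only [QuantumMatrix.complSym_eq hq]
    exact h
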